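/- A trinity is a triangulation of a connected closed oriented surface (several edges may join the same two vertices) whose vertices are colored red, green, blue so that adjacent vertices have different colors; an edge gets the color not occurring at its endpoints. A triangle is black if its vertices are red, green, blue in counter-clockwise order, and white otherwise. A planar trinity $\mathcal T$ is a trinity on the sphere with a fixed outer white triangle, whose vertices are called the roots. A state (Tutte matching) is a perfect matching between the non-outer white triangles and the non-root vertices in which matched objects are incident. Consider a cycle formed by a red, a green and a blue edge of $\mathcal T$; it bounds a disk on the side opposite to the three white triangles that are incident to its edges. (The boundary of a black triangle is an example.) If a state matches these three white triangles with the three vertices of the cycle, each with an endpoint of its edge on the cycle, then there are two ways to do so. In the clockwise one, the white triangles at the red, green, blue edge are matched to the green, blue, red vertex, respectively; in the counter-clockwise one, to the blue, red, green vertex. A clockwise move changes the clockwise position to the counter-clockwise one and leaves all other matches unchanged. The state transition graph has the states as its vertices, with an edge between two states if a clockwise move leads from one to the other. For each color $X$ and each white triangle $w$ there is an arrow of color $X$ across $w$: it ends at the vertex of color $X$ of $w$ and starts at the vertex of color $X$ of the black triangle on the other side of the edge of color $X$ of $w$. These arrows are the edges of a directed graph on the vertices of color $X$, the dual of the graph formed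 by the edges of color $X$. Its clocked arborescence is built by a greedy search, started at the root of color $X$ in the outer triangle: turn counter-clockwise about the current vertex; whenever the initial end of an arrow is met whose terminal point has not been reached before, select that arrow and continue at its terminal point, starting next to the arrow; after a full turn about a vertex, backtrack along the arrow that led to it and continue the turn about the preceding vertex. Theorem. Let $\mathcal T$ be a planar trinity. (1) The state transition graph of $\mathcal T$ is connected (in particular, states exist). (2) The relation "$t$ can be reached from $s$ by clockwise moves" is a partial order on the set of states that makes it a distributive lattice. It has a minimum $a$, which is the only state into which no clockwise move leads. For each state $s$, all sequences of clockwise moves from $a$ to $s$ contain the move about each given cycle the same number of times; let $\varphi_s$ denote the resulting function on the set of cycles of the above kind. Then $s\mapsto\varphi_s$ is injective, $s\le t$ if and only if $\varphi_s\le\varphi_t$, and the meet and the join of $s$ and $t$ are the states described by $\min\{\varphi_s,\varphi_t\}$ and $\max\{\varphi_s,\varphi_t\}$, respectively. (3) The lattice has a maximum, which is the only state that admits no clockwise move. It is the clocked state: for each color $X$, the clocked arborescence of color $X$ is a spanning arborescence rooted at the root of color $X$, and the white triangles matched to vertices of color $X$ are those carrying its arrows. (4) If $\mathcal T$ is irreducible,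 then all clock moves are about (boundaries of) black triangles, so that $\varphi_s$ is a function on the set of black triangles. Here the connected sum of a trinity with a spherical trinity is formed by replacing a black triangle of the former with the latter minus one of its white triangles, and $\mathcal T$ is irreducible if it has at least two white triangles and, whenever it is presented as a connected sum, one of the summands has only one white and one black triangle. -/

import Mathlib

/-- The three colours of vertices: `0` is red, `1` is green, `2` is blue. -/
abbrev Color : Type := ZMod 3

/-- A closed oriented surface obtained by gluing white triangles (the elements of `W`) to black
triangles (the elements of `B`). Every triangle has one vertex and one edge of each colour, and the
edge of colour `c` is the one opposite to the vertex of colour `c`. In counter-clockwise order the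
vertices of a black triangle are red, green, blue, and those of a white triangle are
blue, green, red. The edge of colour `c` of the white triangle `w` is glued, respecting the
colours of its endpoints, to the edge of colour `c` of the black triangle `glue c w`. Edges of
colour `c` thus correspond to white triangles, and to black triangles. -/
structure Gluing (W B : Type*) where
  glue : Color → W ≃ B

namespace Gluing

variable {W B W₀ B₀ : Type*} (T : Gluing W B)

/-- The counter-clockwise turn about vertices of colour `c`, from one white triangle to the next:
one leaves the white triangle through its edge of colour `c + 2` and the following black triangle
through its edge of colour `c + 1`. -/
def rot (c : Color) : Equiv.Perm W :=
  (T.glue (c + 2)).trans (T.glue (c + 1)).symm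

/-- The vertices of colour `c` are the cycles of the turn `rot c`. -/
def Vertex : Type _ :=
  Σ c : Color, Quotient (Equiv.Perm.SameCycle.setoid (T.rot c))

/-- The vertex of colour `c` of the white triangle `w`. -/
def vertex (c : Color) (w : W) : T.Vertex :=
  ⟨c, Quotient.mk (Equiv.Perm.SameCycle.setoid (T.rot c)) w⟩

/-- The vertex of colour `c` of the black triangle `b`: it is also a vertex of the white triangle
on the other side of the edge of colour `c + 1` of `b`. -/
def blackVertex (c : Color) (b : B) : T.Vertex :=
  T.vertex c ((T.glue (c + 1)).symm b)

/-- The surface is connected: it is nonempty, and one can get between any two white triangles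
through triangles that share edges. -/
def Connected : Prop :=
  Nonempty W ∧ ∀ w w' : W, Relation.ReflTransGen (fun x y => ∃ c d, T.glue c x = T.glue d y) w w'

/-- The Euler characteristic is `2`. The surface has `3 n` edges and `2 n` triangles, where `n` is
the number of white triangles. -/
def EulerTwo : Prop :=
  (Nat.card T.Vertex : ℤ) - 3 * Nat.card W + 2 * Nat.card W = 2

/-- Isomorphism, preserving the orientation and all colours. -/
def Iso (T : Gluing W B) (T₀ : Gluing W₀ B₀) : Prop :=
  ∃ (f : W ≃ W₀) (g : B ≃ B₀), ∀ c w, g (T.glue c w) = T₀.glue c (f w)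

open Classical in
/-- Connected sum: the black triangle `Δ` of `T` is replaced by `T₀` minus its white triangle `o`. -/
noncomputable def connectedSum (T : Gluing W B) (Δ : B) (T₀ : Gluing W₀ B₀) (o : W₀) :
    Gluing (W ⊕ {w : W₀ // w ≠ o}) ({b : B // b ≠ Δ} ⊕ B₀) where
  glue c :=
    { toFun := Sum.elim
        (fun w => if h : T.glue c w = Δ then Sum.inr (T₀.glue c o) else Sum.inl ⟨T.glue c w, h⟩)
        (fun w => Sum.inr (T₀.glue c w))
      invFun := Sum.elim
        (fun b => Sum.inl ((T.glue c).symm b))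
        (fun b => if h : (T₀.glue c).symm b = o then Sum.inl ((T.glue c).symm Δ)
          else Sum.inr ⟨(T₀.glue c).symm b, h⟩)
      left_inv := by
        rintro (w | ⟨w, hw⟩)
        · by_cases h : T.glue c w = Δ
          · subst h
            simp
          · simp [h]
        · simp [hw]
      right_inv := by
        rintro (⟨b, hb⟩ | b)
        · simp [hb]
        · by_cases h : (T₀.glue c).symm b = o
          · subst h
            simp
          · simp [h] }

/-- Irreducible: there are at least two white triangles, and in every presentation as a connected
sum of a trinity (on any surface) with a spherical one, one summand is the trivial trinity, which
consists of one white and one black triangle. -/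
def Irreducible (T : Gluing W B) : Prop :=
  2 ≤ Nat.card W ∧
    ∀ (W₁ B₁ W₂ B₂ : Type) (T₁ : Gluing W₁ B₁) (Δ : B₁) (T₂ : Gluing W₂ B₂) (o : W₂),
      Finite W₁ → Finite W₂ → T₁.Connected → T₂.Connected → T₂.EulerTwo →
        Iso T (connectedSum T₁ Δ T₂ o) → Nat.card W₁ = 1 ∨ Nat.card W₂ = 1

end Gluing

/-- A planar trinity: a properly three-coloured triangulation of the sphere, with a fixed outer
white triangle. -/
structure PlanarTrinity (W B : Type*) extends Gluing W B where
  connected : toGluing.Connected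
  eulerTwo : toGluing.EulerTwo
  outer : W

namespace PlanarTrinity

variable {W B : Type*} (T : PlanarTrinity W B)

/-- The root of colour `c`. -/
def root (c : Color) : T.Vertex := T.vertex c T.outer

/-- A state, or Tutte matching: a perfect matching between the non-outer white triangles and the
non-root vertices in which matched objects are incident. -/
structure State where
  toEquiv : {w : W // w ≠ T.outer} ≃ {v : T.Vertex // ∀ c, v ≠ T.root c}
  incident : ∀ w, ∃ c, (toEquiv w : T.Vertex) = T.vertex c w

variable {T} in
/-- The white triangle `w` is matched to the vertex `v`. -/
def State.Matches (s : T.State) (w : W) (v : T.Vertex) : Prop :=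
  ∃ h : w ≠ T.outer, (s.toEquiv ⟨w, h⟩ : T.Vertex) = v

/-- The place of a clock move: a red, a green and a blue edge forming a cycle of length three. The
edge of colour `c` is recorded by the white triangle `tri c` that is incident to it, and the
condition says that the edges of colours `c + 1` and `c + 2` have the same endpoint of colour `c`.
When the cycle is traversed in the order red, green, blue of its vertices, the three white
triangles lie to its right; on the sphere the cycle bounds a disk to its left. -/
@[ext] structure Site where
  tri : Color → W
  cycle : ∀ c, T.vertex c (tri (c + 1)) = T.vertex c (tri (c + 2))

/-- The site given by the boundary of a black triangle. -/
def blackSite (b : B) : T.Site where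
  tri c := (T.glue c).symm b
  cycle c := by
    refine congrArg (Sigma.mk c) (Quotient.sound ?_)
    refine Equiv.Perm.SameCycle.symm ⟨1, ?_⟩
    simp [Gluing.rot]

/-- The clockwise move at the site `σ` leads from `s` to `t`. At each of the three edges, of
colour `c`, the incident white triangle is matched to the endpoint of colour `c + 1` in the
clockwise position and to the endpoint of colour `c + 2` in the counter-clockwise position. -/
def ClockwiseMove (σ : T.Site) (s t : T.State) : Prop :=
  (∀ c, s.Matches (σ.tri c) (T.vertex (c + 1) (σ.tri c))) ∧
  (∀ c, t.Matches (σ.tri c) (T.vertex (c + 2) (σ.tri c))) ∧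
  ∀ w, (∀ c, w ≠ σ.tri c) → ∀ v, s.Matches w v ↔ t.Matches w v

/-- The state transition graph. -/
def transitionGraph : SimpleGraph T.State :=
  SimpleGraph.fromRel fun s t => ∃ σ, T.ClockwiseMove σ s t

/-- `T.ClockwisePath s l t`: performing clockwise moves at the sites listed in `l` (in this order)
leads from `s` to `t`. -/
inductive ClockwisePath : T.State → List T.Site → T.State → Prop
  | nil (s : T.State) : ClockwisePath s [] s
  | cons {σ : T.Site} {l : List T.Site} {s t u : T.State} :
      T.ClockwiseMove σ s t → ClockwisePath t l u → ClockwisePath s (σ :: l) u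

open Classical in
/-- `φ` records, for every state `s`, how many times the clockwise move at each site is performed
on the way from `a` to `s`: there are clockwise paths from `a` to `s`, and all of them have
the multiplicities `φ s`. -/
def IsMultiplicity (a : T.State) (φ : T.State → T.Site → ℕ) : Prop :=
  ∀ s, (∃ l, T.ClockwisePath a l s) ∧ ∀ l, T.ClockwisePath a l s → ∀ σ, l.count σ = φ s σ

/-! The arrows of colour `c` are the edges of the dual, with respect to the sphere, of the graph
formed by the edges of colour `c`. There is one across each white triangle `w`: it starts
at the vertex of colour `c` of the black triangle `glue c w`, crosses the edge of colour `c`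
and `w`, and ends at the vertex of colour `c` of `w`. -/

/-- The initial point of the arrow of colour `c` across `w`. -/
def arrowTail (c : Color) (w : W) : T.Vertex := T.blackVertex c (T.glue c w)

/-- The terminal point of the arrow of colour `c` across `w`. -/
def arrowHead (c : Color) (w : W) : T.Vertex := T.vertex c w

/-- The arrows of colour `c` across the triangles in `A` form a spanning arborescence rooted at the
root of colour `c`: every vertex of colour `c` is reached from the root along `A`, exactly one
arrow of `A` points to each non-root vertex of colour `c`, and none to the root. -/
def IsSpanningArborescence (c : Color) (A : Set W) : Prop :=
  (∀ v : T.Vertex, v.1 = c →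
    Relation.ReflTransGen (fun x y => ∃ w ∈ A, T.arrowTail c w = x ∧ T.arrowHead c w = y)
      (T.root c) v) ∧
  (∀ v : T.Vertex, v.1 = c → v ≠ T.root c → ∃! w, w ∈ A ∧ T.arrowHead c w = v) ∧
  ∀ w ∈ A, T.arrowHead c w ≠ T.root c

open Classical in
/-- One step of the greedy construction of the clocked arborescence of colour `c`, whose arrows
selected so far are those across the triangles in `A`. One turns counter-clockwise about a vertex
of colour `c`, meeting white triangles, which contain terminal ends of arrows, and black
triangles, which contain initial ends of arrows, alternately.

* At a white triangle `w` whose arrow is selected, the full turn about its head is complete: one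
  backtracks along the arrow and continues the turn about its tail.
* At any other white triangle one continues the turn.
* At a black triangle `b` containing the initial end of the arrow across `a`, if the head of
  that arrow is the root or the head of a selected arrow, one continues the turn.
* Otherwise the arrow is selected, and one begins the turn about its head, next to the arrow. -/
noncomputable def clockedStep (c : Color) : (W ⊕ B) × Set W → (W ⊕ B) × Set W
  | (Sum.inl w, A) =>
      if w ∈ A then (Sum.inl ((T.glue (c + 1)).symm (T.glue c w)), A)
      else (Sum.inr (T.glue (c + 2) w), A)
  | (Sum.inr b, A) =>
      let a := (T.glue c).symm b
      if T.arrowHead c a = T.root c ∨ ∃ a' ∈ A, T.arrowHead c a' = T.arrowHead c a then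
        (Sum.inl ((T.glue (c + 1)).symm b), A)
      else (Sum.inr (T.glue (c + 2) a), insert a A)

/-- The clocked arborescence of colour `c`: the arrows that get selected when one starts at the
root, in the outer triangle, with no arrow selected. (Nothing is selected any more after the first
full turn about the root.) -/
def clockedArborescence (c : Color) : Set W :=
  {w | ∃ k : ℕ, w ∈ ((T.clockedStep c)^[k] (Sum.inl T.outer, ∅)).2}

/-- The clocked state: for each colour `c`, the triangles matched to vertices of colour `c` are the
ones that carry the arrows of the clocked arborescence of colour `c`. -/
def IsClockedState (s : T.State) : Prop :=
  ∀ c w, s.Matches w (T.vertex c w) ↔ w ∈ T.clockedArborescence c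

end PlanarTrinity

/-!
The incidence graph joins every white triangle to its three vertices, and its faces are the black
triangles. Two states are perfect matchings of it, so their difference is a cycle; on the sphere it
is the boundary of a height function on the black triangles. Around the set where the height is
maximal one finds a cycle along which the state can be rematched, and by Euler's formula such a
cycle encloses as many vertices as triangles only if its length is three, so it is the place of a
clock move. Hence a state without clockwise moves is unique. Two moves out of the same state take
place at disjoint triangles and commute, so, as for chip firing, the states reachable from the
minimum form a distributive lattice, embedded by the numbers of moves at the sites. Comparing the
greedy search with a maximal state shows that this state matches along every arrow selected. In an
irreducible trinity, finally, the disk inside the cycle of a move can be cut out as a summand of a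
connected sum, and so it is a single black triangle.
-/

section Orthogonal

open Module LinearMap

variable {K E M N : Type*} [Field K] [LinearOrder K] [IsStrictOrderedRing K] [Fintype E]
  [AddCommGroup M] [Module K M] [AddCommGroup N] [Module K N]
  {f : M →ₗ[K] E → K} {g : N →ₗ[K] E → K}

theorem disjoint_range_of_dotProduct_eq_zero (hfg : ∀ x y, f x ⬝ᵥ g y = 0) :
    Disjoint (range f) (range g) := by
  rw [Submodule.disjoint_def]
  rintro _ ⟨x, rfl⟩ ⟨y, hy⟩
  rw [← dotProduct_self_eq_zero]
  nth_rw 2 [← hy]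
  exact hfg x y

variable [FiniteDimensional K M] [FiniteDimensional K N]

theorem finrank_sup_range_of_dotProduct_eq_zero (hfg : ∀ x y, f x ⬝ᵥ g y = 0) :
    finrank K ↥(range f ⊔ range g) + finrank K (ker f) + finrank K (ker g) =
      finrank K M + finrank K N := by
  have hsup := Submodule.finrank_sup_add_finrank_inf_eq (range f) (range g)
  rw [(disjoint_range_of_dotProduct_eq_zero hfg).eq_bot, finrank_bot] at hsup
  have hf := f.finrank_range_add_finrank_ker
  have hg := g.finrank_range_add_finrank_ker
  omega

theorem finrank_add_finrank_le_of_dotProduct_eq_zero (hfg : ∀ x y, f x ⬝ᵥ g y = 0) :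
    finrank K M + finrank K N ≤ Nat.card E + finrank K (ker f) + finrank K (ker g) := by
  have hle := Submodule.finrank_le (range f ⊔ range g)
  rw [finrank_pi, ← Nat.card_eq_fintype_card] at hle
  have := finrank_sup_range_of_dotProduct_eq_zero hfg
  omega

theorem mem_range_of_dotProduct_eq_zero (hfg : ∀ x y, f x ⬝ᵥ g y = 0)
    (hcard : Nat.card E + finrank K (ker f) + finrank K (ker g) ≤ finrank K M + finrank K N)
    {z : E → K} (hz : ∀ y, z ⬝ᵥ g y = 0) : z ∈ range f := by
  have htop : range f ⊔ range g = ⊤ := by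
    apply Submodule.eq_top_of_finrank_eq
    have hle := Submodule.finrank_le (range f ⊔ range g)
    have := finrank_sup_range_of_dotProduct_eq_zero hfg
    rw [finrank_pi, ← Nat.card_eq_fintype_card] at hle ⊢
    omega
  obtain ⟨_, ⟨x, rfl⟩, _, ⟨y, rfl⟩, rfl⟩ := Submodule.mem_sup.1 (htop ▸ Submodule.mem_top (x := z))
  have hy : g y = 0 := by simpa [add_dotProduct, hfg] using hz y
  exact ⟨x, by rw [hy, add_zero]⟩

end Orthogonal

theorem exists_distribLattice_of_injective {α β : Type*} [DistribLattice β] {f : α → β}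
    (hf : Function.Injective f) (hsup : ∀ x y, ∃ z, f z = f x ⊔ f y)
    (hinf : ∀ x y, ∃ z, f z = f x ⊓ f y) :
    ∃ D : DistribLattice α, (∀ x y, D.le x y ↔ f x ≤ f y) ∧
      (∀ x y, f (D.inf x y) = f x ⊓ f y) ∧ ∀ x y, f (D.sup x y) = f x ⊔ f y := by
  choose sup hsup using hsup
  choose inf hinf using hinf
  let : Max α := ⟨sup⟩
  let : Min α := ⟨inf⟩
  let : LE α := ⟨fun x y => f x ≤ f y⟩
  let : LT α := ⟨fun x y => f x < f y⟩
  exact ⟨hf.distribLattice f Iff.rfl Iff.rfl hsup hinf, fun _ _ => Iff.rfl, hinf, hsup⟩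

theorem exists_rank_of_reflTransGen {V : Type*} (R : V → V → Prop) (o : V) :
    ∃ r : V → ℕ, ∀ v, Relation.ReflTransGen R o v → v ≠ o → ∃ u, R u v ∧ r u < r v := by
  let P : ℕ → V → Prop := fun n => (fun p v => ∃ u, p u ∧ R u v)^[n] (· = o)
  have hP_succ {n : ℕ} {v : V} : P (n + 1) v ↔ ∃ u, P n u ∧ R u v := by
    simp only [P, Function.iterate_succ_apply']
  have hP (v) (hv : Relation.ReflTransGen R o v) : ∃ n, P n v := by
    induction hv with
    | refl => exact ⟨0, rfl⟩
    | tail _ h ih =>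
      obtain ⟨n, hn⟩ := ih
      exact ⟨n + 1, hP_succ.2 ⟨_, hn, h⟩⟩
  refine ⟨fun v => sInf {n | P n v}, fun v hv hvo => ?_⟩
  have hmin : P (sInf {n | P n v}) v := Nat.sInf_mem (hP v hv)
  dsimp only
  generalize sInf {n | P n v} = n at hmin
  cases n with
  | zero => exact absurd hmin hvo
  | succ n =>
    obtain ⟨u, hu, huv⟩ := hP_succ.1 hmin
    exact ⟨u, huv, Nat.lt_succ_of_le (Nat.sInf_le hu)⟩

theorem exists_finset_mapsTo_of_mapsTo {α : Type*} [Finite α] {f : α → α} {S : Set α}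
    (hf : Set.MapsTo f S S) (hS : S.Nonempty) :
    ∃ K : Finset α, ↑K ⊆ S ∧ K.Nonempty ∧ Set.MapsTo f K K ∧
      ∀ x ∈ K, ∀ y ∈ K, ∃ n, f^[n] x = y := by
  obtain ⟨K, hKS, hK⟩ := exists_minimal_le_of_wellFoundedLT
    (fun K : Set α => K.Nonempty ∧ Set.MapsTo f K K) S ⟨hS, hf⟩
  lift K to Finset α using K.toFinite
  refine ⟨K, hKS, hK.prop.1, hK.prop.2, fun x hx y hy => ?_⟩
  have horbit : Set.MapsTo f (Set.range fun n => f^[n] x) (Set.range fun n => f^[n] x) := by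
    rintro _ ⟨n, rfl⟩
    exact ⟨n + 1, Function.iterate_succ_apply' f n x⟩
  refine hK.le_of_le ⟨Set.range_nonempty _, horbit⟩ ?_ hy
  rintro _ ⟨n, rfl⟩
  exact hK.prop.2.iterate n hx

/-! ### Commuting moves -/

/-- `LabeledPath M s l t`: performing the moves with the labels in `l`, in this order, leads from
`s` to `t`, where `M σ x y` says that the move with label `σ` leads from `x` to `y`. -/
inductive LabeledPath {S L : Type*} (M : L → S → S → Prop) : S → List L → S → Prop
  | nil (s : S) : LabeledPath M s [] s
  | cons {σ : L} {l : List L} {s t u : S} :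
      M σ s t → LabeledPath M t l u → LabeledPath M s (σ :: l) u

/-- A sink of a system of moves is a state that admits no move. -/
def IsSink {S L : Type*} (M : L → S → S → Prop) (s : S) : Prop := ∀ σ t, ¬ M σ s t

/-- A system of moves is commuting if moves are determined by their label and their source, and
moves with different labels from the same source can be performed one after the other, with the
same result in both orders. -/
structure IsCommuting {S L : Type*} (M : L → S → S → Prop) : Prop where
  target_eq : ∀ {σ s t u}, M σ s t → M σ s u → t = u
  exists_join : ∀ {σ τ s t u}, M σ s t → M τ s u → σ ≠ τ → ∃ v, M τ t v ∧ M σ u v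

section Moves

variable {S L : Type*} {M : L → S → S → Prop} {s t u x y : S} {l l' : List L} {σ : L}

namespace LabeledPath

theorem append (h : LabeledPath M s l t) (h' : LabeledPath M t l' u) :
    LabeledPath M s (l ++ l') u := by
  induction h with
  | nil => exact h'
  | cons h _ ih => exact cons h (ih h')

theorem reverse (h : LabeledPath M s l t) : LabeledPath (fun σ => flip (M σ)) t l.reverse s := by
  induction h with
  | nil s => exact nil s
  | cons h _ ih =>
    rw [List.reverse_cons]
    exact ih.append (cons h (nil _))

theorem eq_of_nil (h : LabeledPath M s [] t) : s = t := by cases h; rfl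

theorem eq_of_count_eq_zero [DecidableEq L] (h : LabeledPath M s l t) (hl : ∀ σ, l.count σ = 0) :
    s = t := by
  obtain rfl : l = [] :=
    List.eq_nil_iff_forall_not_mem.2 fun σ => List.count_eq_zero.1 (hl σ)
  exact h.eq_of_nil

end LabeledPath

theorem IsSink.eq_of_path (hs : IsSink M s) (h : LabeledPath M s l t) : s = t := by
  cases h with
  | nil => rfl
  | cons h => exact absurd h (hs _ _)

theorem exists_path_to_sink [Finite S] {α : Type*} [Preorder α] {r : S → α}
    (hr : ∀ σ s t, M σ s t → r s < r t) (s : S) : ∃ l t, LabeledPath M s l t ∧ IsSink M t := by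
  have : IsTrans S (fun t s => r s < r t) := ⟨fun _ _ _ h h' => h'.trans h⟩
  have : Std.Irrefl (fun t s : S => r s < r t) := ⟨fun _ h => lt_irrefl _ h⟩
  have wf := Finite.wellFounded_of_trans_of_irrefl (fun t s : S => r s < r t)
  induction s using wf.induction with
  | _ s ih =>
    by_cases h : IsSink M s
    · exact ⟨[], s, .nil s, h⟩
    · obtain ⟨σ, u, hu⟩ : ∃ σ u, M σ s u := by simpa [IsSink] using h
      obtain ⟨l, t, hl, ht⟩ := ih u (hr σ s u hu)
      exact ⟨σ :: l, t, .cons hu hl, ht⟩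

theorem exists_isSink_of_unique [Finite S] [Nonempty S] {α : Type*} [Preorder α] {r : S → α}
    (hr : ∀ σ s t, M σ s t → r s < r t) (hM : ∀ s t, IsSink M s → IsSink M t → s = t) :
    ∃ m, IsSink M m ∧ ∀ s, ∃ l, LabeledPath M s l m := by
  obtain ⟨-, m, -, hm⟩ := exists_path_to_sink hr (Classical.arbitrary S)
  refine ⟨m, hm, fun s => ?_⟩
  obtain ⟨l, t, hl, ht⟩ := exists_path_to_sink hr s
  exact ⟨l, hM t m ht hm ▸ hl⟩

theorem IsSink.iff_eq {m : S} (hm : IsSink M m) (hup : ∀ s, ∃ l, LabeledPath M s l m) {s : S} :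
    IsSink M s ↔ s = m :=
  ⟨fun hs => (hup s).elim fun _ hl => hs.eq_of_path hl, fun h => h ▸ hm⟩

namespace IsCommuting

theorem exists_strip (hM : IsCommuting M) (hy : M σ x y) (ht : LabeledPath M x l t) :
    (∃ l', LabeledPath M y l' t ∧ l.Perm (σ :: l')) ∨
      σ ∉ l ∧ ∃ t' l', M σ t t' ∧ LabeledPath M y l' t' ∧ l'.Perm l := by
  induction ht generalizing y with
  | nil x => exact Or.inr ⟨by simp, y, [], hy, .nil y, .refl _⟩
  | @cons τ l x u t hu ht ih =>
    by_cases hστ : σ = τ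
    · subst hστ
      rw [← hM.target_eq hy hu] at ht
      exact Or.inl ⟨l, ht, .refl _⟩
    · obtain ⟨v, hyv, huv⟩ := hM.exists_join hy hu hστ
      rcases ih huv with ⟨l', hl', hp⟩ | ⟨hσ, t', l', htt', hl', hp⟩
      · exact Or.inl ⟨τ :: l', .cons hyv hl', (hp.cons τ).trans (.swap σ τ l')⟩
      · exact Or.inr ⟨by simp [hστ, hσ], t', τ :: l', htt', .cons hyv hl', hp.cons τ⟩

theorem exists_join_path [DecidableEq L] (hM : IsCommuting M) (hs : LabeledPath M x l s)
    (ht : LabeledPath M x l' t) :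
    ∃ j k k', LabeledPath M s k j ∧ LabeledPath M t k' j ∧
      ∀ ρ, l.count ρ + k.count ρ = max (l.count ρ) (l'.count ρ) ∧
        l'.count ρ + k'.count ρ = max (l.count ρ) (l'.count ρ) := by
  induction hs generalizing t l' with
  | nil x => exact ⟨t, l', [], ht, .nil t, by simp⟩
  | @cons σ l x y s hy _ ih =>
    rcases hM.exists_strip hy ht with ⟨l₁, h₁, hp⟩ | ⟨hσ, t', l₁, htt', h₁, hp⟩
    · obtain ⟨j, k, k', hk, hk', hc⟩ := ih h₁
      refine ⟨j, k, k', hk, hk', fun ρ => ?_⟩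
      have := hc ρ
      rw [hp.count_eq, List.count_cons, List.count_cons]
      omega
    · obtain ⟨j, k, k', hk, hk', hc⟩ := ih h₁
      refine ⟨j, k, σ :: k', hk, .cons htt' hk', fun ρ => ?_⟩
      have := hc ρ
      rw [hp.count_eq] at this
      rw [List.count_cons, List.count_cons]
      by_cases hρ : σ = ρ
      · subst hρ
        rw [List.count_eq_zero.2 hσ] at this ⊢
        simp only [beq_self_eq_true, if_true]
        omega
      · simp only [beq_iff_eq, hρ, if_false]
        omega

theorem sink_eq (hM : IsCommuting M) (hs : LabeledPath M x l s) (ht : LabeledPath M x l' t)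
    (hs' : IsSink M s) (ht' : IsSink M t) : s = t := by
  classical
  obtain ⟨j, k, k', hk, hk', -⟩ := hM.exists_join_path hs ht
  exact (hs'.eq_of_path hk).trans (ht'.eq_of_path hk').symm

theorem perm_of_isSink (hM : IsCommuting M) (ht : IsSink M t) (h : LabeledPath M s l t)
    (h' : LabeledPath M s l' t) : l.Perm l' := by
  induction h generalizing l' with
  | nil s =>
    cases h' with
    | nil => exact .refl _
    | cons h => exact absurd h (ht _ _)
  | cons hy _ ih =>
    rcases hM.exists_strip hy h' with ⟨l₁, h₁, hp⟩ | ⟨-, t', -, htt', -, -⟩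
    · exact ((ih ht h₁).cons _).trans hp.symm
    · exact absurd htt' (ht _ _)

end IsCommuting

/-- `φ s` counts, for each label, the moves with this label on the way from `a` to `s`: there are
such paths, and all of them have the label counts `φ s`. -/
structure IsLabelCount [DecidableEq L] (M : L → S → S → Prop) (a : S) (φ : S → L → ℕ) : Prop where
  exists_path : ∀ s, ∃ l, LabeledPath M a l s
  count_eq : ∀ {s l}, LabeledPath M a l s → ∀ σ, l.count σ = φ s σ

theorem IsCommuting.exists_isLabelCount [DecidableEq L] (hM : IsCommuting M) {a m : S}
    (hm : IsSink M m) (hup : ∀ s, ∃ l, LabeledPath M s l m)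
    (hdown : ∀ s, ∃ l, LabeledPath M a l s) : ∃ φ, IsLabelCount M a φ := by
  choose p hp using hdown
  refine ⟨fun s σ => (p s).count σ, fun s => ⟨p s, hp s⟩, fun {s l} hl σ => ?_⟩
  obtain ⟨k, hk⟩ := hup s
  have hperm := hM.perm_of_isSink hm (hl.append hk) ((hp s).append hk)
  exact ((List.perm_append_right_iff k).1 hperm).count_eq σ

namespace IsLabelCount

variable [DecidableEq L] {a : S} {φ : S → L → ℕ}

theorem apply_eq_add (hφ : IsLabelCount M a φ) (h : LabeledPath M s l t) (σ : L) :
    φ t σ = φ s σ + l.count σ := by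
  obtain ⟨p, hp⟩ := hφ.exists_path s
  rw [← hφ.count_eq (hp.append h), List.count_append, hφ.count_eq hp]

theorem exists_sup (hφ : IsLabelCount M a φ) (hM : IsCommuting M) (s t : S) :
    ∃ j, φ j = φ s ⊔ φ t := by
  obtain ⟨p, hp⟩ := hφ.exists_path s
  obtain ⟨q, hq⟩ := hφ.exists_path t
  obtain ⟨j, k, _, hk, -, hc⟩ := hM.exists_join_path hp hq
  refine ⟨j, funext fun σ => ?_⟩
  rw [hφ.apply_eq_add hk, ← hφ.count_eq hp, (hc σ).1, hφ.count_eq hp, hφ.count_eq hq]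
  rfl

theorem exists_inf (hφ : IsLabelCount M a φ) (hM : IsCommuting fun σ => flip (M σ)) {m : S}
    (hup : ∀ s, ∃ l, LabeledPath M s l m) (s t : S) : ∃ j, φ j = φ s ⊓ φ t := by
  obtain ⟨l, hl⟩ := hup s
  obtain ⟨l', hl'⟩ := hup t
  obtain ⟨j, k, _, hk, -, hc⟩ := hM.exists_join_path hl.reverse hl'.reverse
  refine ⟨j, funext fun σ => ?_⟩
  have hj := hφ.apply_eq_add hk.reverse σ
  have hs := hφ.apply_eq_add hl σ
  have ht := hφ.apply_eq_add hl' σ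
  have hmax := (hc σ).1
  simp only [List.count_reverse] at hj hmax
  change φ j σ = min (φ s σ) (φ t σ)
  omega

theorem le_iff (hφ : IsLabelCount M a φ) (hM : IsCommuting M) :
    φ s ≤ φ t ↔ ∃ l, LabeledPath M s l t := by
  constructor
  · intro hst
    obtain ⟨p, hp⟩ := hφ.exists_path s
    obtain ⟨q, hq⟩ := hφ.exists_path t
    obtain ⟨j, k, k', hk, hk', hc⟩ := hM.exists_join_path hp hq
    have htj : t = j := hk'.eq_of_count_eq_zero fun σ => by
      have := (hc σ).2
      rw [hφ.count_eq hp, hφ.count_eq hq, max_eq_right (hst σ)] at this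
      omega
    exact ⟨k, htj ▸ hk⟩
  · rintro ⟨l, hl⟩ σ
    exact (Nat.le_add_right _ _).trans_eq (hφ.apply_eq_add hl σ).symm

theorem injective (hφ : IsLabelCount M a φ) (hM : IsCommuting M) : Function.Injective φ := by
  intro s t hst
  obtain ⟨l, hl⟩ := (hφ.le_iff hM).1 hst.le
  refine hl.eq_of_count_eq_zero fun σ => ?_
  have := hφ.apply_eq_add hl σ
  rw [hst] at this
  omega

end IsLabelCount

end Moves

namespace Color

theorem eq_or_eq_add_one_or_eq_add_two (c d : Color) : d = c ∨ d = c + 1 ∨ d = c + 2 := by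
  decide +revert

@[simp] theorem add_one_add_one (c : Color) : c + 1 + 1 = c + 2 := by decide +revert
@[simp] theorem add_one_add_two (c : Color) : c + 1 + 2 = c := by decide +revert
@[simp] theorem add_two_add_one (c : Color) : c + 2 + 1 = c := by decide +revert
@[simp] theorem add_two_add_two (c : Color) : c + 2 + 2 = c + 1 := by decide +revert
@[simp] theorem two_ne_zero : (2 : Color) ≠ 0 := by decide
@[simp] theorem one_ne_two : (1 : Color) ≠ 2 := by decide
@[simp] theorem two_ne_one : (2 : Color) ≠ 1 := by decide

theorem exists_ne_ne (c d : Color) : ∃ e, c ≠ e ∧ d ≠ e := by decide +revert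

theorem eq_of_ne {c d x y : Color} (hxc : x ≠ c) (hdc : d ≠ c) (hdx : d ≠ x) (hyc : y ≠ c)
    (hyx : y ≠ x) : d = y := by
  have huniq : ∀ c d x y : Color, x ≠ c ∧ d ≠ c ∧ d ≠ x ∧ y ≠ c ∧ y ≠ x → d = y := by decide
  exact huniq c d x y ⟨hxc, hdc, hdx, hyc, hyx⟩

theorem sum_eq {M : Type*} [AddCommMonoid M] (f : Color → M) (c : Color) :
    ∑ e, f e = f c + f (c + 1) + f (c + 2) := by
  have huniv : (Finset.univ : Finset Color) = {c, c + 1, c + 2} := by decide +revert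
  rw [huniv, Finset.sum_insert (by decide +revert), Finset.sum_insert (by decide +revert),
    Finset.sum_singleton, add_assoc]

end Color

namespace Gluing

variable {W B : Type*} (T : Gluing W B)

/-! ### Vertices -/

instance [Finite W] : Finite T.Vertex := by
  unfold Gluing.Vertex; infer_instance

@[simp] theorem vertex_fst (c : Color) (w : W) : (T.vertex c w).1 = c := rfl

theorem vertex_eq_iff {c : Color} {w w' : W} :
    T.vertex c w = T.vertex c w' ↔ (T.rot c).SameCycle w w' :=
  ⟨fun h => Quotient.exact (eq_of_heq (Sigma.mk.inj h).2),
    fun h => congrArg (Sigma.mk c) (Quotient.sound h)⟩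

theorem color_eq_of_vertex_eq {c c' : Color} {w w' : W} (h : T.vertex c w = T.vertex c' w') :
    c = c' := congrArg Sigma.fst h

theorem exists_vertex_eq (v : T.Vertex) : ∃ w, T.vertex v.1 w = v := by
  obtain ⟨c, q⟩ := v
  induction q using Quotient.inductionOn with
  | h w => exact ⟨w, rfl⟩

@[simp] theorem glue_rot (c : Color) (w : W) :
    T.glue (c + 1) (T.rot c w) = T.glue (c + 2) w := by simp [rot]

@[simp] theorem vertex_rot (c : Color) (w : W) : T.vertex c (T.rot c w) = T.vertex c w :=
  T.vertex_eq_iff.2 (Equiv.Perm.SameCycle.symm ⟨1, by simp⟩)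

theorem blackVertex_glue {c d : Color} (h : d ≠ c) (w : W) :
    T.blackVertex c (T.glue d w) = T.vertex c w := by
  rcases Color.eq_or_eq_add_one_or_eq_add_two c d with rfl | rfl | rfl
  · exact absurd rfl h
  · simp [blackVertex]
  · rw [← glue_rot, blackVertex, Equiv.symm_apply_apply, vertex_rot]

theorem vertex_glue_symm {c d : Color} (h : d ≠ c) (b : B) :
    T.vertex c ((T.glue d).symm b) = T.blackVertex c b := by
  rw [← T.blackVertex_glue h, Equiv.apply_symm_apply]

theorem exists_blackVertex_eq (v : T.Vertex) : ∃ b, T.blackVertex v.1 b = v := by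
  obtain ⟨w, hw⟩ := T.exists_vertex_eq v
  exact ⟨T.glue (v.1 + 1) w, by rw [T.blackVertex_glue (by simp), hw]⟩

variable {T}

theorem Connected.induction (hT : T.Connected) {p : W → Prop}
    (hp : ∀ b c d, p ((T.glue c).symm b) → p ((T.glue d).symm b)) {w : W} (hw : p w) (w' : W) :
    p w' := by
  induction hT.2 w w' with
  | refl => exact hw
  | tail _ hyz ih =>
    obtain ⟨c, d, hcd⟩ := hyz
    have := hp (T.glue c _) c d (by rwa [Equiv.symm_apply_apply])
    rwa [hcd, Equiv.symm_apply_apply] at this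

theorem connected_of_induction [Nonempty W]
    (hT : ∀ p : W → Prop, (∀ b c d, p ((T.glue c).symm b) → p ((T.glue d).symm b)) →
      ∀ w w', p w → p w') : T.Connected :=
  ⟨inferInstance, fun w w' =>
    hT (Relation.ReflTransGen (fun x y => ∃ c d, T.glue c x = T.glue d y) w)
      (fun b c d h => h.tail ⟨c, d, by simp⟩) w w' .refl⟩

theorem Connected.eq_of_forall_glue (hT : T.Connected) {α : Type*} {h : B → α}
    (hh : ∀ w c d, h (T.glue c w) = h (T.glue d w)) (b b' : B) : h b = h b' := by
  have hconst : ∀ c, h (T.glue c ((T.glue 0).symm b')) = h b := by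
    refine hT.induction (p := fun w => ∀ c, h (T.glue c w) = h b) (fun b₁ c d h₁ e => ?_)
      (w := (T.glue 0).symm b) (fun c => by rw [hh _ c 0, Equiv.apply_symm_apply]) _
    rw [hh _ e d, Equiv.apply_symm_apply]
    simpa only [Equiv.apply_symm_apply] using h₁ c
  rw [← hconst 0, Equiv.apply_symm_apply]

variable (T)

/-! ### Chains of the incidence graph -/

/-- The cellular boundary for the incidence graph of white triangles and vertices, whose edges are
the pairs `(w, c)` that join `w` to its vertex of colour `c`, oriented towards the vertex. Its faces
are the black triangles, enlarged by the adjacent parts of white triangles. -/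
def boundary : (B → ℚ) →ₗ[ℚ] (W × Color → ℚ) :=
  LinearMap.funLeft ℚ ℚ (fun e => T.glue (e.2 + 1) e.1) -
    LinearMap.funLeft ℚ ℚ fun e => T.glue (e.2 + 2) e.1

/-- The sum over the two ends of an edge of the incidence graph. Up to the sign on white triangles
this is the coboundary of the incidence graph, which is bipartite. -/
def endSum : (W ⊕ T.Vertex → ℚ) →ₗ[ℚ] (W × Color → ℚ) :=
  LinearMap.funLeft ℚ ℚ (fun e => Sum.inl e.1) +
    LinearMap.funLeft ℚ ℚ fun e => Sum.inr (T.vertex e.2 e.1)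

theorem boundary_apply (h : B → ℚ) (w : W) (c : Color) :
    T.boundary h (w, c) = h (T.glue (c + 1) w) - h (T.glue (c + 2) w) := rfl

theorem endSum_apply (u : W ⊕ T.Vertex → ℚ) (w : W) (c : Color) :
    T.endSum u (w, c) = u (Sum.inl w) + u (Sum.inr (T.vertex c w)) := rfl

theorem boundary_dotProduct_endSum [Fintype W] (h : B → ℚ) (u : W ⊕ T.Vertex → ℚ) :
    T.boundary h ⬝ᵥ T.endSum u = 0 := by
  rw [dotProduct, Fintype.sum_prod_type]
  simp only [boundary_apply, endSum_apply, mul_add, Finset.sum_add_distrib]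
  have hwhite (w : W) :
      ∑ c : Color, (h (T.glue (c + 1) w) - h (T.glue (c + 2) w)) * u (Sum.inl w) = 0 := by
    rw [Color.sum_eq _ 0]
    simp only [Color.add_one_add_one, Color.add_one_add_two, Color.add_two_add_one,
      Color.add_two_add_two]
    ring
  have hvertex (c : Color) :
      ∑ w, (h (T.glue (c + 1) w) - h (T.glue (c + 2) w)) * u (Sum.inr (T.vertex c w)) = 0 := by
    simp only [sub_mul, Finset.sum_sub_distrib]
    rw [sub_eq_zero, ← Equiv.sum_comp (T.rot c)]
    simp only [glue_rot, vertex_rot]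
  rw [Finset.sum_congr rfl fun w _ => hwhite w, Finset.sum_const_zero, zero_add, Finset.sum_comm]
  exact Finset.sum_eq_zero fun c _ => hvertex c

variable {T}

theorem eq_of_boundary_eq_zero {h : B → ℚ} {w : W} (hw : ∀ c, T.boundary h (w, c) = 0)
    (c d : Color) : h (T.glue c w) = h (T.glue d w) := by
  have h₀ := hw (c + 2)
  have h₁ := hw (c + 1)
  simp only [boundary_apply, Color.add_one_add_one, Color.add_one_add_two, Color.add_two_add_one,
    Color.add_two_add_two] at h₀ h₁
  rcases Color.eq_or_eq_add_one_or_eq_add_two c d with rfl | rfl | rfl <;> linarith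

theorem Connected.eq_of_mem_ker_boundary (hT : T.Connected) {h : B → ℚ} (hh : T.boundary h = 0)
    (b b' : B) : h b = h b' :=
  hT.eq_of_forall_glue (fun _ => eq_of_boundary_eq_zero fun _ => congrFun hh _) b b'

theorem Connected.eq_of_boundary_eq (hT : T.Connected) {h h' : B → ℚ}
    (hh : T.boundary h = T.boundary h') {b₀ : B} (h₀ : h b₀ = h' b₀) : h = h' := by
  have hsub : T.boundary (h - h') = 0 := by rw [map_sub, hh, sub_self]
  ext b
  have := hT.eq_of_mem_ker_boundary hsub b b₀
  rwa [Pi.sub_apply, Pi.sub_apply, h₀, sub_self, sub_eq_zero] at this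

theorem Connected.finrank_ker_boundary (hT : T.Connected) :
    Module.finrank ℚ (LinearMap.ker T.boundary) = 1 := by
  obtain ⟨w⟩ := hT.1
  have hone : T.boundary (fun _ => 1) = 0 := by ext e; simp [boundary]
  refine finrank_eq_one (⟨_, hone⟩ : LinearMap.ker T.boundary) (fun h => ?_) fun ⟨h, hh⟩ => ?_
  · exact one_ne_zero (congrFun (congrArg Subtype.val h) (T.glue 0 w))
  · refine ⟨h (T.glue 0 w), Subtype.ext (funext fun b => ?_)⟩
    simpa using hT.eq_of_mem_ker_boundary hh (T.glue 0 w) b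

theorem Connected.eq_of_mem_ker_endSum (hT : T.Connected) {u : W ⊕ T.Vertex → ℚ}
    (hu : T.endSum u = 0) (w : W) :
    (∀ w', u (Sum.inl w') = u (Sum.inl w)) ∧ ∀ v, u (Sum.inr v) = -u (Sum.inl w) := by
  have hvertex (w' : W) (c : Color) : u (Sum.inr (T.vertex c w')) = -u (Sum.inl w') := by
    have : u (Sum.inl w') + u (Sum.inr (T.vertex c w')) = 0 := congrFun hu (w', c)
    linarith
  have hwhite : ∀ w', u (Sum.inl w') = u (Sum.inl w) := by
    refine hT.induction (p := fun w' => u (Sum.inl w') = u (Sum.inl w)) (fun b c d h => ?_) rfl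
    obtain ⟨e, hce, hde⟩ := Color.exists_ne_ne c d
    have hc := hvertex ((T.glue c).symm b) e
    have hd := hvertex ((T.glue d).symm b) e
    rw [T.vertex_glue_symm hce] at hc
    rw [T.vertex_glue_symm hde] at hd
    linarith
  refine ⟨hwhite, fun v => ?_⟩
  obtain ⟨w', hw'⟩ := T.exists_vertex_eq v
  rw [← hw', hvertex, hwhite]

theorem Connected.finrank_ker_endSum (hT : T.Connected) :
    Module.finrank ℚ (LinearMap.ker T.endSum) = 1 := by
  obtain ⟨w⟩ := hT.1
  have hsign : T.endSum (Sum.elim (fun _ => 1) fun _ => -1) = 0 := by ext e; simp [endSum]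
  refine finrank_eq_one (⟨_, hsign⟩ : LinearMap.ker T.endSum) (fun h => ?_) fun ⟨u, hu⟩ => ?_
  · exact one_ne_zero (congrFun (congrArg Subtype.val h) (Sum.inl w))
  · obtain ⟨hwhite, hvertex⟩ := hT.eq_of_mem_ker_endSum hu w
    refine ⟨u (Sum.inl w), Subtype.ext (funext ?_)⟩
    rintro (w' | v) <;> simp [hwhite, hvertex]

theorem Connected.card_vertex_le [Finite W] (hT : T.Connected) :
    Nat.card T.Vertex ≤ Nat.card W + 2 := by
  have := Fintype.ofFinite W
  have := Fintype.ofEquiv W (T.glue 0)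
  have := Fintype.ofFinite T.Vertex
  have h := finrank_add_finrank_le_of_dotProduct_eq_zero T.boundary_dotProduct_endSum
  rw [hT.finrank_ker_boundary, hT.finrank_ker_endSum, Module.finrank_pi, Module.finrank_pi] at h
  simp only [← Nat.card_eq_fintype_card, Nat.card_sum, Nat.card_prod, Nat.card_zmod,
    ← Nat.card_congr (T.glue 0)] at h
  omega

/-- Being orthogonal to the image of `endSum` is the cycle condition: cycles are boundaries. -/
theorem Connected.mem_range_boundary [Fintype W] (hT : T.Connected) (hT' : T.EulerTwo)
    {x : W × Color → ℚ} (hx : ∀ u, x ⬝ᵥ T.endSum u = 0) : x ∈ LinearMap.range T.boundary := by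
  have := Fintype.ofEquiv W (T.glue 0)
  have := Fintype.ofFinite T.Vertex
  refine mem_range_of_dotProduct_eq_zero T.boundary_dotProduct_endSum ?_ hx
  rw [hT.finrank_ker_boundary, hT.finrank_ker_endSum, Module.finrank_pi, Module.finrank_pi]
  simp only [← Nat.card_eq_fintype_card, Nat.card_sum, Nat.card_prod, Nat.card_zmod,
    ← Nat.card_congr (T.glue 0)]
  unfold EulerTwo at hT'
  omega

theorem le_of_boundary_nonneg [Finite W] {h : B → ℚ} {c : Color} {w : W}
    (hx : ∀ u, T.vertex c u = T.vertex c w → u ≠ w → 0 ≤ T.boundary h (u, c)) {b : B}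
    (hb : T.blackVertex c b = T.vertex c w) : h b ≤ h (T.glue (c + 2) w) := by
  have hpow (i : ℕ) : h (T.glue (c + 2) ((T.rot c ^ i) w)) ≤ h (T.glue (c + 2) w) := by
    induction i with
    | zero => exact le_rfl
    | succ i ih =>
      rw [pow_succ', Equiv.Perm.mul_apply]
      by_cases hi : T.rot c ((T.rot c ^ i) w) = w
      · rw [hi]
      · have hvertex : T.vertex c (T.rot c ((T.rot c ^ i) w)) = T.vertex c w := by
          rw [vertex_rot, eq_comm, T.vertex_eq_iff]
          exact ⟨i, by rw [zpow_natCast]⟩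
        have := hx _ hvertex hi
        rw [boundary_apply, glue_rot] at this
        linarith
  rw [← T.vertex_glue_symm (d := c + 2) (by simp), eq_comm, T.vertex_eq_iff] at hb
  obtain ⟨i, hi⟩ := hb.exists_nat_pow_eq
  simpa only [hi, Equiv.apply_symm_apply] using hpow i

end Gluing

theorem ncard_eq_sum_ite {α : Type*} [Fintype α] (s : Set α) [DecidablePred (· ∈ s)] :
    s.ncard = ∑ x, if x ∈ s then 1 else 0 := by
  rw [Set.ncard_eq_toFinset_card', Set.toFinset, ← Finset.card_filter]
  congr 1
  ext x
  simp

namespace Gluing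

variable {W B : Type*} (T : Gluing W B)

/-! ### Regions -/

/-- The white triangles with an edge on a black triangle of the region `D`. -/
def regionTriangles (D : Set B) : Set W := {w | ∃ c, T.glue c w ∈ D}

/-- The vertices of the black triangles of the region `D`. -/
def regionVertices (D : Set B) : Set T.Vertex := {v | ∃ b ∈ D, T.blackVertex v.1 b = v}

/-- The edges of the incidence graph that bound a face in the region `D`. -/
def regionEdges (D : Set B) : Set (W × Color) :=
  {e | T.glue (e.2 + 1) e.1 ∈ D ∨ T.glue (e.2 + 2) e.1 ∈ D}

/-- A region `D` of black triangles bounded by a cycle that follows the white triangles in `K`: of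
such a triangle, only the edge of colour `col w + 2` is incident to `D`, and it connects the
vertices of colours `col w` and `col w + 1`; the cycle continues with the triangle `f w`. -/
structure IsRegion (D : Set B) (K : Finset W) (col : W → Color) (f : W → W) : Prop where
  nonempty : K.Nonempty
  glue_mem_iff : ∀ w ∈ K, ∀ d, T.glue d w ∈ D ↔ d = col w + 2
  glue_mem : ∀ w ∉ K, ∀ c d, T.glue c w ∈ D → T.glue d w ∈ D
  vertex_eq : ∀ w ∈ K, T.vertex (col (f w)) (f w) = T.vertex (col w + 1) w
  mapsTo : Set.MapsTo f K K
  trans : ∀ w ∈ K, ∀ w' ∈ K, ∃ n, f^[n] w = w'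

variable {T} {D : Set B} {K : Finset W} {col : W → Color} {f : W → W}

theorem vertex_mem_regionVertices {w : W} {c : Color} (h : (w, c) ∈ T.regionEdges D) :
    T.vertex c w ∈ T.regionVertices D := by
  rcases h with h | h <;> exact ⟨_, h, T.blackVertex_glue (by simp) w⟩

theorem mem_regionTriangles_of_mem_regionEdges {w : W} {c : Color}
    (h : (w, c) ∈ T.regionEdges D) : w ∈ T.regionTriangles D :=
  h.elim (fun h => ⟨_, h⟩) fun h => ⟨_, h⟩

theorem mem_regionEdges_of_ne {w : W} {c d : Color} (hd : d ≠ c) (h : T.glue d w ∈ D) :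
    (w, c) ∈ T.regionEdges D := by
  rcases Color.eq_or_eq_add_one_or_eq_add_two c d with rfl | rfl | rfl
  · exact absurd rfl hd
  · exact Or.inl h
  · exact Or.inr h

namespace IsRegion

theorem exists_notMem (hD : T.IsRegion D K col f) : ∃ b, b ∉ D := by
  obtain ⟨w, hw⟩ := hD.nonempty
  exact ⟨T.glue (col w) w, by simp [hD.glue_mem_iff w hw]⟩

theorem mem_regionEdges (hD : T.IsRegion D K col f) {w : W} (hw : w ∈ K) :
    (w, col w) ∈ T.regionEdges D ∧ (w, col w + 1) ∈ T.regionEdges D :=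
  ⟨Or.inr ((hD.glue_mem_iff w hw _).2 rfl), Or.inl ((hD.glue_mem_iff w hw _).2 (by simp))⟩

theorem mem_regionTriangles (hD : T.IsRegion D K col f) {w : W} (hw : w ∈ K) :
    w ∈ T.regionTriangles D := ⟨_, (hD.glue_mem_iff w hw _).2 rfl⟩

theorem vertex_mem_regionVertices (hD : T.IsRegion D K col f) {w : W} (hw : w ∈ T.regionTriangles D)
    (hwK : w ∉ K) (c : Color) : T.vertex c w ∈ T.regionVertices D :=
  hw.elim fun d hd => Gluing.vertex_mem_regionVertices (Or.inl (hD.glue_mem w hwK d _ hd))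

theorem vertex_col_mem_regionVertices (hD : T.IsRegion D K col f) {w : W}
    (hw : w ∈ T.regionTriangles D) : T.vertex (col w) w ∈ T.regionVertices D := by
  by_cases hwK : w ∈ K
  · exact Gluing.vertex_mem_regionVertices (hD.mem_regionEdges hwK).1
  · exact hD.vertex_mem_regionVertices hw hwK _

theorem induction (hD : T.IsRegion D K col f) (hT : T.Connected) {p : W → Prop}
    (hf : ∀ w ∈ K, p w → p (f w))
    (hp : ∀ b ∈ D, ∀ c d, p ((T.glue c).symm b) → p ((T.glue d).symm b)) {w₀ : W} (hw₀ : w₀ ∈ K)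
    (h₀ : p w₀) {w : W} (hw : w ∈ T.regionTriangles D) : p w := by
  have hiterate (n : ℕ) : f^[n] w₀ ∈ K ∧ p (f^[n] w₀) := by
    induction n with
    | zero => exact ⟨hw₀, h₀⟩
    | succ n ih =>
      rw [Function.iterate_succ_apply']
      exact ⟨hD.mapsTo ih.1, hf _ ih.1 ih.2⟩
  have hK : ∀ w ∈ K, p w := fun w hw => by
    obtain ⟨n, rfl⟩ := hD.trans w₀ hw₀ w hw
    exact (hiterate n).2
  refine hT.induction (p := fun w => w ∈ T.regionTriangles D → p w) (fun b c d h hd => ?_)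
    (fun _ => h₀) w hw
  by_cases hdK : (T.glue d).symm b ∈ K
  · exact hK _ hdK
  obtain ⟨e, he⟩ := hd
  have hb : b ∈ D := by simpa using hD.glue_mem _ hdK e d he
  exact hp b hb c d (h ⟨c, by simpa using hb⟩)

theorem ncard_regionEdges (hD : T.IsRegion D K col f) [Finite W] :
    (T.regionEdges D).ncard + K.card = 3 * (T.regionTriangles D).ncard := by
  classical
  have := Fintype.ofFinite W
  have hK : K.card = ∑ w, if w ∈ K then 1 else 0 := by simp
  rw [ncard_eq_sum_ite, ncard_eq_sum_ite, Fintype.sum_prod_type, hK, Finset.mul_sum,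
    ← Finset.sum_add_distrib]
  refine Finset.sum_congr rfl fun w _ => ?_
  by_cases hw : w ∈ K
  · rw [Color.sum_eq _ (col w), if_pos (hD.mem_regionEdges hw).1, if_pos (hD.mem_regionEdges hw).2,
      if_neg (by simp [regionEdges, hD.glue_mem_iff w hw]), if_pos hw,
      if_pos (hD.mem_regionTriangles hw)]
    rfl
  · by_cases hw' : w ∈ T.regionTriangles D
    · have hedge (c : Color) : (w, c) ∈ T.regionEdges D :=
        hw'.elim fun d hd => Or.inl (hD.glue_mem w hw d _ hd)
      simp [hedge, hw, hw']
    · have hedge (c : Color) : (w, c) ∉ T.regionEdges D :=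
        fun h => hw' (mem_regionTriangles_of_mem_regionEdges h)
      simp [hedge, hw, hw']

theorem ncard_faces (hD : T.IsRegion D K col f) [Finite W] :
    3 * D.ncard + 2 * K.card = 3 * (T.regionTriangles D).ncard := by
  classical
  have := Fintype.ofFinite W
  have := Fintype.ofEquiv W (T.glue 0)
  have hK : K.card = ∑ w, if w ∈ K then 1 else 0 := by simp
  have hface (c : Color) : D.ncard = ∑ w, if T.glue c w ∈ D then 1 else 0 := by
    rw [Equiv.sum_comp (T.glue c) fun b => if b ∈ D then 1 else 0, ncard_eq_sum_ite]
  have hfaces : 3 * D.ncard = ∑ w, ∑ c, if T.glue c w ∈ D then 1 else 0 := by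
    rw [Finset.sum_comm, ← Finset.sum_congr rfl fun c _ => hface c, Finset.sum_const,
      Finset.card_univ, ZMod.card, smul_eq_mul]
  rw [hfaces, ncard_eq_sum_ite (T.regionTriangles D), hK, Finset.mul_sum, Finset.mul_sum,
    ← Finset.sum_add_distrib]
  refine Finset.sum_congr rfl fun w _ => ?_
  by_cases hw : w ∈ K
  · simp [hD.glue_mem_iff w hw, hw, hD.mem_regionTriangles hw]
  · by_cases hw' : w ∈ T.regionTriangles D
    · have hglue (c : Color) : T.glue c w ∈ D := hw'.elim fun d hd => hD.glue_mem w hw d _ hd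
      simp [hglue, hw, hw']
    · have hglue (c : Color) : T.glue c w ∉ D := fun h => hw' ⟨c, h⟩
      simp [hglue, hw, hw']

end IsRegion

variable (T D)

/-- The restriction of `boundary` to the chains of faces in the region `D`. -/
noncomputable def regionBoundary : (D → ℚ) →ₗ[ℚ] (T.regionEdges D → ℚ) :=
  LinearMap.funLeft ℚ ℚ Subtype.val ∘ₗ T.boundary ∘ₗ
    Function.ExtendByZero.linearMap ℚ Subtype.val

/-- The analogue of `endSum` for the incidence graph of the region `D`. -/
def regionEndSum :
    (T.regionTriangles D ⊕ T.regionVertices D → ℚ) →ₗ[ℚ] (T.regionEdges D → ℚ) :=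
  LinearMap.funLeft ℚ ℚ
      (fun e => Sum.inl ⟨e.1.1, mem_regionTriangles_of_mem_regionEdges e.2⟩) +
    LinearMap.funLeft ℚ ℚ
      fun e => Sum.inr ⟨T.vertex e.1.2 e.1.1, vertex_mem_regionVertices e.2⟩

variable {T D}

theorem boundary_extend_eq_zero (h : D → ℚ) {e : W × Color} (he : e ∉ T.regionEdges D) :
    T.boundary (Function.extend Subtype.val h 0) e = 0 := by
  have hzero {b : B} (hb : b ∉ D) : Function.extend Subtype.val h (0 : B → ℚ) b = 0 :=
    Function.extend_apply' h (0 : B → ℚ) b fun ⟨b', hb'⟩ => hb (hb' ▸ b'.2)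
  obtain ⟨h₁, h₂⟩ := not_or.1 he
  rw [boundary_apply, hzero h₁, hzero h₂, sub_zero]

theorem regionBoundary_dotProduct_regionEndSum [Finite W] [Fintype (T.regionEdges D)] (h : D → ℚ)
    (u : T.regionTriangles D ⊕ T.regionVertices D → ℚ) :
    T.regionBoundary D h ⬝ᵥ T.regionEndSum D u = 0 := by
  have := Fintype.ofFinite W
  let h' : B → ℚ := Function.extend Subtype.val h 0
  let u' : W ⊕ T.Vertex → ℚ := Function.extend (Sum.map Subtype.val Subtype.val) u 0
  have hu' (x) : u' (Sum.map Subtype.val Subtype.val x) = u x :=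
    (Sum.map_injective.2 ⟨Subtype.val_injective, Subtype.val_injective⟩).extend_apply u 0 x
  have hend (e : T.regionEdges D) : T.regionEndSum D u e = T.endSum u' e :=
    congrArg₂ (· + ·) (hu' (Sum.inl _)).symm (hu' (Sum.inr _)).symm
  calc T.regionBoundary D h ⬝ᵥ T.regionEndSum D u
      = ∑ e : T.regionEdges D, T.boundary h' e * T.endSum u' e :=
        Finset.sum_congr rfl fun e _ => by rw [hend]; rfl
    _ = T.boundary h' ⬝ᵥ T.endSum u' := by
        rw [Finset.sum_set_coe (f := fun e => T.boundary h' e * T.endSum u' e)]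
        refine Finset.sum_subset (Finset.subset_univ _) fun e _ he => ?_
        rw [boundary_extend_eq_zero h (by simpa using he), zero_mul]
    _ = 0 := T.boundary_dotProduct_endSum h' u'

theorem eq_neg_of_regionEndSum_eq_zero {u : T.regionTriangles D ⊕ T.regionVertices D → ℚ}
    (hu : T.regionEndSum D u = 0) {w : W} {c : Color} (he : (w, c) ∈ T.regionEdges D)
    {v : T.Vertex} (hv : v ∈ T.regionVertices D) (hcw : T.vertex c w = v) :
    u (Sum.inr ⟨v, hv⟩) = -u (Sum.inl ⟨w, mem_regionTriangles_of_mem_regionEdges he⟩) := by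
  subst hcw
  have : u (Sum.inl _) + u (Sum.inr _) = 0 := congrFun hu ⟨(w, c), he⟩
  linarith

namespace IsRegion

theorem finrank_ker_regionBoundary (hD : T.IsRegion D K col f) (hT : T.Connected) :
    Module.finrank ℚ (LinearMap.ker (T.regionBoundary D)) = 0 := by
  rw [LinearMap.ker_eq_bot'.2, finrank_bot]
  intro h hh
  obtain ⟨b₀, hb₀⟩ := hD.exists_notMem
  have hboundary : T.boundary (Function.extend Subtype.val h 0) = T.boundary 0 := by
    ext e
    rw [map_zero]
    by_cases he : e ∈ T.regionEdges D
    · exact congrFun hh ⟨e, he⟩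
    · exact boundary_extend_eq_zero h he
  have hzero := hT.eq_of_boundary_eq hboundary (b₀ := b₀)
    (Function.extend_apply' h (0 : B → ℚ) b₀ fun ⟨b, hb⟩ => hb₀ (hb ▸ b.2))
  ext b
  rw [← Subtype.val_injective.extend_apply h (0 : B → ℚ) b, hzero]
  rfl

theorem finrank_ker_regionEndSum_le (hD : T.IsRegion D K col f) (hT : T.Connected) :
    Module.finrank ℚ (LinearMap.ker (T.regionEndSum D)) ≤ 1 := by
  obtain ⟨w₀, hw₀⟩ := hD.nonempty
  refine finrank_le_one (⟨Sum.elim (fun _ => 1) fun _ => -1, by ext; simp [regionEndSum]⟩ :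
    LinearMap.ker (T.regionEndSum D)) fun ⟨u, hu⟩ =>
      ⟨u (Sum.inl ⟨w₀, hD.mem_regionTriangles hw₀⟩), Subtype.ext ?_⟩
  have htriangle (w : W) (hw : w ∈ T.regionTriangles D) :
      u (Sum.inl ⟨w, hw⟩) = u (Sum.inl ⟨w₀, hD.mem_regionTriangles hw₀⟩) := by
    refine hD.induction hT (p := fun w => ∀ hw : w ∈ T.regionTriangles D,
      u (Sum.inl ⟨w, hw⟩) = u (Sum.inl ⟨w₀, hD.mem_regionTriangles hw₀⟩))
      (fun w hw h hfw => ?_) (fun b hb c d h hd => ?_) hw₀ (fun _ => rfl) hw hw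
    · have hv := Gluing.vertex_mem_regionVertices (hD.mem_regionEdges hw).2
      have h₁ := eq_neg_of_regionEndSum_eq_zero hu (hD.mem_regionEdges hw).2 hv rfl
      have h₂ := eq_neg_of_regionEndSum_eq_zero hu (hD.mem_regionEdges (hD.mapsTo hw)).1 hv
        (hD.vertex_eq _ hw)
      linarith [h (hD.mem_regionTriangles hw)]
    · obtain ⟨e, hec, hed⟩ := Color.exists_ne_ne c d
      have hc : T.glue c ((T.glue c).symm b) ∈ D := by simpa using hb
      have hd' : T.glue d ((T.glue d).symm b) ∈ D := by simpa using hb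
      have hv := Gluing.vertex_mem_regionVertices (mem_regionEdges_of_ne hec hc)
      have h₁ := eq_neg_of_regionEndSum_eq_zero hu (mem_regionEdges_of_ne hec hc) hv rfl
      have h₂ := eq_neg_of_regionEndSum_eq_zero hu (mem_regionEdges_of_ne hed hd') hv
        (by rw [T.vertex_glue_symm hec, T.vertex_glue_symm hed])
      linarith [h ⟨c, hc⟩]
  ext (⟨w, hw⟩ | ⟨v, b, hb, hv⟩)
  · simpa using (htriangle w hw).symm
  · have hb' : T.glue (v.1 + 1) ((T.glue (v.1 + 1)).symm b) ∈ D := by simpa using hb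
    have := eq_neg_of_regionEndSum_eq_zero hu (mem_regionEdges_of_ne (by simp) hb') ⟨b, hb, hv⟩ hv
    rw [htriangle] at this
    simp [this]

theorem euler_le (hD : T.IsRegion D K col f) (hT : T.Connected) [Finite W] :
    D.ncard + ((T.regionTriangles D).ncard + (T.regionVertices D).ncard) ≤
      (T.regionEdges D).ncard + 1 := by
  have := Fintype.ofFinite W
  have := Fintype.ofFinite (T.regionEdges D)
  have : Finite B := .of_equiv W (T.glue 0)
  have := Fintype.ofFinite D
  have := Fintype.ofFinite (T.regionTriangles D)
  have := Fintype.ofFinite (T.regionVertices D)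
  have h := finrank_add_finrank_le_of_dotProduct_eq_zero
    (regionBoundary_dotProduct_regionEndSum (T := T) (D := D))
  rw [hD.finrank_ker_regionBoundary hT, Module.finrank_pi, Module.finrank_pi] at h
  simp only [← Nat.card_eq_fintype_card, Nat.card_sum, Nat.card_coe_set_eq] at h
  have := hD.finrank_ker_regionEndSum_le hT
  omega

theorem ncard_regionVertices_le (hD : T.IsRegion D K col f) (hT : T.Connected) [Finite W] :
    3 * (T.regionVertices D).ncard + K.card ≤ 3 * (T.regionTriangles D).ncard + 3 := by
  have heuler := hD.euler_le hT
  have hfaces := hD.ncard_faces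
  have hedges := hD.ncard_regionEdges
  omega

end IsRegion

end Gluing

namespace PlanarTrinity

variable {W B : Type*} {T : PlanarTrinity W B}

/-! ### States and heights -/

theorem root_injective (T : PlanarTrinity W B) : Function.Injective T.root :=
  fun _ _ h => T.color_eq_of_vertex_eq h

namespace State

open Classical in
/-- The colour of the vertex matched to a non-outer white triangle; `0` at the outer triangle. -/
noncomputable def color (s : T.State) (w : W) : Color :=
  if h : w ≠ T.outer then (s.incident ⟨w, h⟩).choose else 0

theorem matches_color (s : T.State) {w : W} (h : w ≠ T.outer) :
    s.Matches w (T.vertex (s.color w) w) := by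
  refine ⟨h, ?_⟩
  rw [color, dif_pos h]
  exact (s.incident ⟨w, h⟩).choose_spec

variable {s t : T.State} {w w' : W} {v v' : T.Vertex} {c : Color}

theorem Matches.ne_outer (h : s.Matches w v) : w ≠ T.outer := h.1

theorem Matches.ne_root (h : s.Matches w v) (c : Color) : v ≠ T.root c := by
  obtain ⟨hw, rfl⟩ := h
  exact (s.toEquiv ⟨w, hw⟩).2 c

theorem Matches.vertex_eq (h : s.Matches w v) (h' : s.Matches w v') : v = v' := by
  obtain ⟨_, rfl⟩ := h
  obtain ⟨_, rfl⟩ := h'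
  rfl

theorem Matches.triangle_eq (h : s.Matches w v) (h' : s.Matches w' v) : w = w' := by
  obtain ⟨hw, hv⟩ := h
  obtain ⟨hw', hv'⟩ := h'
  exact congrArg Subtype.val (s.toEquiv.injective (Subtype.ext (hv.trans hv'.symm)))

theorem Matches.eq_vertex_color (h : s.Matches w v) : v = T.vertex (s.color w) w :=
  h.vertex_eq (s.matches_color h.ne_outer)

theorem Matches.color_eq (h : s.Matches w (T.vertex c w')) : s.color w = c :=
  (T.color_eq_of_vertex_eq h.eq_vertex_color).symm

theorem matches_vertex_iff : s.Matches w (T.vertex c w) ↔ w ≠ T.outer ∧ s.color w = c := by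
  refine ⟨fun h => ⟨h.ne_outer, h.color_eq⟩, ?_⟩
  rintro ⟨h, rfl⟩
  exact s.matches_color h

theorem injOn_vertex_color (s : T.State) :
    Set.InjOn (fun w => T.vertex (s.color w) w) {w | w ≠ T.outer} := by
  intro w hw w' hw' (hww' : T.vertex _ w = T.vertex _ w')
  exact (hww' ▸ s.matches_color hw).triangle_eq (s.matches_color hw')

theorem exists_matches (s : T.State) (hv : ∀ c, v ≠ T.root c) : ∃ w, s.Matches w v :=
  ⟨s.toEquiv.symm ⟨v, hv⟩, (s.toEquiv.symm ⟨v, hv⟩).2, by simp⟩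

theorem ext_matches (h : ∀ w v, s.Matches w v → t.Matches w v) : s = t := by
  have : s.toEquiv = t.toEquiv := by
    ext ⟨w, hw⟩
    exact (h w _ ⟨hw, rfl⟩).2.symm
  cases s; cases t; cases this; rfl

theorem ext_color (h : ∀ w, w ≠ T.outer → s.color w = t.color w) : s = t :=
  ext_matches fun w v hv => by
    rw [hv.eq_vertex_color, h w hv.ne_outer]
    exact t.matches_color hv.ne_outer

instance [Finite W] : Finite T.State :=
  Finite.of_injective (fun s : T.State => s.toEquiv) fun s t h => by cases s; cases t; cases h; rfl

theorem exists_of_perm (s : T.State) (p : Equiv.Perm {w : W // w ≠ T.outer})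
    (hp : ∀ w, ∃ c, (s.toEquiv (p w) : T.Vertex) = T.vertex c w) :
    ∃ t : T.State, ∀ w v, s.Matches (p w : W) v → t.Matches w v :=
  ⟨⟨p.trans s.toEquiv, hp⟩, fun w _ h => ⟨w.2, h.2⟩⟩

open Classical in
/-- The characteristic function of a state, as a perfect matching in the incidence graph. -/
noncomputable def chain (s : T.State) (e : W × Color) : ℚ :=
  if s.Matches e.1 (T.vertex e.2 e.1) then 1 else 0

theorem chain_apply_color (s : T.State) (hw : w ≠ T.outer) (c : Color) :
    s.chain (w, c) = if s.color w = c then 1 else 0 := by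
  simp [chain, matches_vertex_iff, hw]

theorem chain_outer (s : T.State) (c : Color) : s.chain (T.outer, c) = 0 := by
  simp [chain, matches_vertex_iff]

theorem chain_dotProduct_endSum [Fintype W] (s : T.State) (u : W ⊕ T.Vertex → ℚ) :
    s.chain ⬝ᵥ T.endSum u =
      ∑ᶠ w : {w : W // w ≠ T.outer}, u (Sum.inl w.1) +
        ∑ᶠ v : {v : T.Vertex // ∀ c, v ≠ T.root c}, u (Sum.inr v.1) := by
  classical
  have htriangle (w : W) : ∑ c, s.chain (w, c) * T.endSum u (w, c) =
      if w ≠ T.outer then u (Sum.inl w) + u (Sum.inr (T.vertex (s.color w) w)) else 0 := by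
    by_cases hw : w = T.outer
    · simp [hw, chain_outer]
    · simp [chain_apply_color s hw, Gluing.endSum_apply, hw]
  rw [dotProduct, Fintype.sum_prod_type, Finset.sum_congr rfl fun w _ => htriangle w,
    ← Finset.sum_filter, Finset.sum_subtype (p := fun w => w ≠ T.outer) _ (by simp),
    Finset.sum_add_distrib, finsum_eq_sum_of_fintype, ← finsum_comp_equiv s.toEquiv,
    finsum_eq_sum_of_fintype]
  congr 1
  refine Finset.sum_congr rfl fun w _ => ?_
  rw [(s.matches_color w.2).vertex_eq ⟨w.2, rfl⟩]

end State

/-- The function `h` of black triangles is the height of the state `t` relative to `s`. -/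
structure IsHeight (s t : T.State) (h : B → ℚ) : Prop where
  boundary_eq : T.boundary h = t.chain - s.chain
  outer : h (T.glue 0 T.outer) = 0

theorem exists_isHeight [Finite W] (s t : T.State) : ∃ h, IsHeight s t h := by
  have := Fintype.ofFinite W
  obtain ⟨h, hh⟩ := T.connected.mem_range_boundary T.eulerTwo (x := t.chain - s.chain) fun u => by
    rw [sub_dotProduct, State.chain_dotProduct_endSum, State.chain_dotProduct_endSum, sub_self]
  refine ⟨h - fun _ => h (T.glue 0 T.outer), ?_, sub_self _⟩
  rw [map_sub, hh, sub_eq_self]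
  ext e
  exact sub_self _

namespace IsHeight

variable {s t u : T.State} {h h' : B → ℚ}

theorem unique (hh : IsHeight s t h) (hh' : IsHeight s t h') : h = h' :=
  T.connected.eq_of_boundary_eq (hh.boundary_eq.trans hh'.boundary_eq.symm)
    (hh.outer.trans hh'.outer.symm)

theorem add (hh : IsHeight s t h) (hh' : IsHeight t u h') : IsHeight s u (h + h') :=
  ⟨by rw [map_add, hh.boundary_eq, hh'.boundary_eq]; abel, by simp [hh.outer, hh'.outer]⟩

theorem neg (hh : IsHeight s t h) : IsHeight t s (-h) :=
  ⟨by rw [map_neg, hh.boundary_eq]; abel, by simp [hh.outer]⟩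

theorem apply_sub_apply (hh : IsHeight s t h) (w : W) (c : Color) :
    h (T.glue (c + 1) w) - h (T.glue (c + 2) w) = t.chain (w, c) - s.chain (w, c) := by
  rw [← Gluing.boundary_apply, hh.boundary_eq]
  rfl

theorem eq_of_eq_zero (hh : IsHeight s t 0) : s = t := by
  refine State.ext_color fun w hw => ?_
  have hchain := hh.apply_sub_apply w (t.color w)
  rw [State.chain_apply_color _ hw, State.chain_apply_color _ hw] at hchain
  by_contra hne
  simp [hne] at hchain

theorem glue_outer (hh : IsHeight s t h) (c : Color) : h (T.glue c T.outer) = 0 := by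
  rw [← hh.outer]
  refine Gluing.eq_of_boundary_eq_zero (fun c => ?_) c 0
  rw [hh.boundary_eq, Pi.sub_apply, State.chain_outer, State.chain_outer, sub_self]

theorem nonpos_of_blackVertex_eq_root [Finite W] (hh : IsHeight s t h) {c : Color} {b : B}
    (hb : T.blackVertex c b = T.root c) : h b ≤ 0 := by
  rw [← hh.glue_outer (c + 2)]
  refine Gluing.le_of_boundary_nonneg (fun u hu _ => ?_) hb
  have hchain (s : T.State) : s.chain (u, c) = 0 := if_neg fun h => h.ne_root c hu
  rw [hh.boundary_eq, Pi.sub_apply, hchain, hchain, sub_self]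

theorem eq_zero_of_blackVertex_eq_root [Finite W] (hh : IsHeight s t h) {c : Color} {b : B}
    (hb : T.blackVertex c b = T.root c) : h b = 0 :=
  le_antisymm (hh.nonpos_of_blackVertex_eq_root hb)
    (neg_nonpos.1 (hh.neg.nonpos_of_blackVertex_eq_root hb))

end IsHeight

/-! ### Turning cycles -/

/-- A cycle in which every white triangle `w` is followed by the triangle `f w` that the state `s`
matches to the vertex of `w` whose colour comes after that of the vertex matched to `w`. -/
structure IsTurn (s : T.State) (K : Finset W) (f : W → W) : Prop where
  nonempty : K.Nonempty
  mapsTo : Set.MapsTo f K K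
  matches_vertex : ∀ w ∈ K, s.Matches (f w) (T.vertex (s.color w + 1) w)
  trans : ∀ w ∈ K, ∀ w' ∈ K, ∃ n, f^[n] w = w'

open Classical in
/-- The change of `s.chain` when each triangle in `K` is rematched to its vertex of the next
colour. -/
noncomputable def State.shiftChain (s : T.State) (K : Finset W) (e : W × Color) : ℚ :=
  if e.1 ∈ K then (if e.2 = s.color e.1 + 1 then 1 else 0) - (if e.2 = s.color e.1 then 1 else 0)
  else 0

namespace IsTurn

variable {s : T.State} {K : Finset W} {f : W → W}

theorem surjOn (hK : IsTurn s K f) : Set.SurjOn f K K := by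
  intro w hw
  obtain ⟨n, hn⟩ := hK.trans _ (hK.mapsTo hw) w hw
  refine ⟨_, hK.mapsTo.iterate n hw, ?_⟩
  rwa [← Function.iterate_succ_apply, Function.iterate_succ_apply'] at hn

theorem injOn (hK : IsTurn s K f) : Set.InjOn f K :=
  Finset.injOn_of_surjOn_of_card_le f hK.mapsTo hK.surjOn le_rfl

theorem ne_outer (hK : IsTurn s K f) {w : W} (hw : w ∈ K) : w ≠ T.outer := by
  obtain ⟨u, hu, rfl⟩ := hK.surjOn hw
  exact (hK.matches_vertex u hu).ne_outer

theorem color_apply (hK : IsTurn s K f) {w : W} (hw : w ∈ K) : s.color (f w) = s.color w + 1 :=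
  (hK.matches_vertex w hw).color_eq

theorem vertex_eq (hK : IsTurn s K f) {w : W} (hw : w ∈ K) :
    T.vertex (s.color (f w)) (f w) = T.vertex (s.color w + 1) w :=
  (hK.matches_vertex w hw).eq_vertex_color.symm

theorem exists_boundary_eq_shiftChain (hK : IsTurn s K f) [Finite W] :
    ∃ h, T.boundary h = s.shiftChain K := by
  classical
  have := Fintype.ofFinite W
  refine T.connected.mem_range_boundary T.eulerTwo fun u => ?_
  have htriangle (w : W) : ∑ c, s.shiftChain K (w, c) * T.endSum u (w, c) =
      if w ∈ K then u (Sum.inr (T.vertex (s.color (f w)) (f w))) -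
        u (Sum.inr (T.vertex (s.color w) w)) else 0 := by
    by_cases hw : w ∈ K
    · simp [State.shiftChain, Gluing.endSum_apply, hw, sub_mul, hK.vertex_eq hw]
    · simp [State.shiftChain, hw]
  rw [dotProduct, Fintype.sum_prod_type, Finset.sum_congr rfl fun w _ => htriangle w,
    ← Finset.sum_filter, Finset.filter_mem_eq_inter, Finset.univ_inter, Finset.sum_sub_distrib,
    sub_eq_zero]
  exact Finset.sum_nbij f hK.mapsTo hK.injOn hK.surjOn fun _ _ => rfl

variable {h : B → ℚ}

theorem le_apply (hK : IsTurn s K f) [Finite W] (hh : T.boundary h = s.shiftChain K) {w : W}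
    (hw : w ∈ K) : h (T.glue (s.color w + 2) w) ≤ h (T.glue (s.color (f w) + 2) (f w)) := by
  refine Gluing.le_of_boundary_nonneg (fun u hu huw => ?_) ?_
  · rw [hh, State.shiftChain]
    by_cases huK : u ∈ K
    · have hcolor : s.color (f w) ≠ s.color u := fun hc =>
        huw (s.injOn_vertex_color (hK.ne_outer huK) (hK.ne_outer (hK.mapsTo hw))
          (by simpa only [hc] using hu))
      rw [if_pos huK, if_neg (c := s.color (f w) = s.color u) hcolor]
      split_ifs <;> norm_num
    · rw [if_neg huK]
  · rw [hK.vertex_eq hw, hK.color_apply hw]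
    exact T.blackVertex_glue (by simp) w

theorem apply_eq (hK : IsTurn s K f) [Finite W] (hh : T.boundary h = s.shiftChain K) {w w' : W}
    (hw : w ∈ K) (hw' : w' ∈ K) :
    h (T.glue (s.color w + 2) w) = h (T.glue (s.color w' + 2) w') := by
  have hiterate {w : W} (hw : w ∈ K) (n : ℕ) :
      h (T.glue (s.color w + 2) w) ≤ h (T.glue (s.color (f^[n] w) + 2) (f^[n] w)) := by
    induction n with
    | zero => exact le_rfl
    | succ n ih =>
      rw [Function.iterate_succ_apply']
      exact ih.trans (hK.le_apply hh (hK.mapsTo.iterate n hw))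
  obtain ⟨m, hm⟩ := hK.trans w hw w' hw'
  obtain ⟨n, hn⟩ := hK.trans w' hw' w hw
  exact le_antisymm (hm ▸ hiterate hw m) (by simpa only [hn] using hiterate hw' n)

theorem apply_glue_of_mem (hh : T.boundary h = s.shiftChain K) {w : W} (hw : w ∈ K) :
    h (T.glue (s.color w) w) = h (T.glue (s.color w + 2) w) - 1 ∧
      h (T.glue (s.color w + 1) w) = h (T.glue (s.color w + 2) w) - 1 := by
  have h₁ := congrFun hh (w, s.color w)
  have h₂ := congrFun hh (w, s.color w + 1)
  simp only [Gluing.boundary_apply, State.shiftChain, hw, if_true, left_eq_add, add_eq_left,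
    one_ne_zero, if_false, Color.add_one_add_one, Color.add_one_add_two] at h₁ h₂
  constructor <;> linarith

theorem apply_glue_of_notMem (hh : T.boundary h = s.shiftChain K) {w : W} (hw : w ∉ K)
    (c d : Color) : h (T.glue c w) = h (T.glue d w) :=
  Gluing.eq_of_boundary_eq_zero (fun c => by rw [hh]; exact if_neg hw) c d

theorem isRegion (hK : IsTurn s K f) [Finite W] (hh : T.boundary h = s.shiftChain K) {w : W}
    (hw : w ∈ K) : T.IsRegion {b | h b = h (T.glue (s.color w + 2) w)} K s.color f where
  nonempty := hK.nonempty
  glue_mem_iff u hu d := by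
    have h₁ := apply_glue_of_mem hh hu
    rw [hK.apply_eq hh hw hu]
    rcases Color.eq_or_eq_add_one_or_eq_add_two (s.color u) d with rfl | rfl | rfl <;> simp [h₁]
  glue_mem _ hu c d hc := (apply_glue_of_notMem hh hu d c).trans hc
  vertex_eq _ hu := hK.vertex_eq hu
  mapsTo := hK.mapsTo
  trans := hK.trans

theorem add_two_le_ncard_regionVertices (hK : IsTurn s K f) [Finite W] {D : Set B}
    (hD : T.IsRegion D K s.color f) (ho : T.outer ∈ T.regionTriangles D) :
    (T.regionTriangles D).ncard + 2 ≤ (T.regionVertices D).ncard := by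
  let v (w : W) : T.Vertex := T.vertex (s.color w) w
  have hsub : v '' (T.regionTriangles D \ {T.outer}) ∪ Set.range T.root ⊆ T.regionVertices D := by
    rintro _ (⟨w, hw, rfl⟩ | ⟨c, rfl⟩)
    · exact hD.vertex_col_mem_regionVertices hw.1
    · exact hD.vertex_mem_regionVertices ho (fun h => hK.ne_outer h rfl) c
  have hdisj : Disjoint (v '' (T.regionTriangles D \ {T.outer})) (Set.range T.root) := by
    rw [Set.disjoint_left]
    rintro _ ⟨w, hw, rfl⟩ ⟨c, hc⟩
    exact (s.matches_color hw.2).ne_root c hc.symm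
  have hroots : (Set.range T.root).ncard = 3 := by
    rw [← Set.image_univ, Set.ncard_image_of_injective _ T.root_injective, Set.ncard_univ,
      Nat.card_zmod]
  have hle := Set.ncard_le_ncard hsub
  rw [Set.ncard_union_eq hdisj,
    Set.InjOn.ncard_image (s.injOn_vertex_color.mono fun w hw => hw.2)] at hle
  have := Set.ncard_sdiff_singleton_add_one ho
  omega

theorem outer_notMem (hK : IsTurn s K f) [Finite W] {D : Set B}
    (hD : T.IsRegion D K s.color f) : T.outer ∉ T.regionTriangles D := fun h => by
  have := hK.add_two_le_ncard_regionVertices hD h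
  have := hD.ncard_regionVertices_le T.connected
  omega

theorem ncard_regionTriangles_le (hK : IsTurn s K f) [Finite W] {D : Set B}
    (hD : T.IsRegion D K s.color f) : (T.regionTriangles D).ncard ≤ (T.regionVertices D).ncard :=
  Set.ncard_le_ncard_of_injOn (fun w => T.vertex (s.color w) w)
    (fun _ hw => hD.vertex_col_mem_regionVertices hw)
    (s.injOn_vertex_color.mono fun w hw (h : w = T.outer) => hK.outer_notMem hD (h ▸ hw))

theorem card_le (hK : IsTurn s K f) [Finite W] : K.card ≤ 3 := by
  obtain ⟨h, hh⟩ := hK.exists_boundary_eq_shiftChain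
  obtain ⟨w, hw⟩ := hK.nonempty
  have hD := hK.isRegion hh hw
  have := hK.ncard_regionTriangles_le hD
  have := hD.ncard_regionVertices_le T.connected
  omega

end IsTurn

end PlanarTrinity

namespace PlanarTrinity

variable {W B : Type*} {T : PlanarTrinity W B} {s t u : T.State} {σ τ : T.Site}
  {k l c d e : Color} {w : W}

/-! ### Moves -/

theorem Site.vertex_eq (σ : T.Site) (hd : d ≠ c) (he : e ≠ c) :
    T.vertex c (σ.tri d) = T.vertex c (σ.tri e) := by
  rcases (Color.eq_or_eq_add_one_or_eq_add_two c d).resolve_left hd with rfl | rfl <;>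
    rcases (Color.eq_or_eq_add_one_or_eq_add_two c e).resolve_left he with rfl | rfl
  exacts [rfl, σ.cycle c, (σ.cycle c).symm, rfl]

/-- The state `s` matches the triangle at the edge of colour `c` of `σ` to the vertex of colour
`c + k`, for each `c`: this is the clockwise position for `k = 1` and the counter-clockwise
position for `k = 2`. -/
def IsPosition (k : Color) (s : T.State) (σ : T.Site) : Prop :=
  ∀ c, s.Matches (σ.tri c) (T.vertex (c + k) (σ.tri c))

/-- The site `σ` is in position `k` in `s` and in position `l` in `t`, and `s` and `t` agree
elsewhere: a clockwise move for `k = 1`, `l = 2`, and its inverse for `k = 2`, `l = 1`. -/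
structure IsMove (k l : Color) (σ : T.Site) (s t : T.State) : Prop where
  source : IsPosition k s σ
  target : IsPosition l t σ
  matches_iff : ∀ w, (∀ c, w ≠ σ.tri c) → ∀ v, s.Matches w v ↔ t.Matches w v

theorem clockwiseMove_iff : T.ClockwiseMove σ s t ↔ IsMove 1 2 σ s t :=
  ⟨fun h => ⟨h.1, h.2.1, h.2.2⟩, fun h => ⟨h.source, h.target, h.matches_iff⟩⟩

namespace IsPosition

theorem color_tri (h : IsPosition k s σ) (c : Color) : s.color (σ.tri c) = c + k :=
  (h c).color_eq

theorem eq_of_tri_eq (hσ : IsPosition k s σ) (hτ : IsPosition k s τ) (h : σ.tri c = τ.tri d) :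
    c = d := by
  simpa [h, hτ.color_tri] using (hσ.color_tri c).symm

theorem tri_injective (h : IsPosition k s σ) : Function.Injective σ.tri :=
  fun _ _ => h.eq_of_tri_eq h

theorem matches_add (h : IsPosition k s σ) (hk : k ≠ 0) (c : Color) :
    s.Matches (σ.tri (c + k)) (T.vertex (c + (k + k)) (σ.tri c)) := by
  have hkk : ∀ k : Color, k ≠ 0 → k + k ≠ 0 := by decide
  rw [σ.vertex_eq (d := c) (by simpa using hkk k hk)
    (e := c + k) (by simpa [← add_assoc] using hk), ← add_assoc]
  exact h (c + k)

theorem site_eq (hσ : IsPosition k s σ) (hτ : IsPosition k s τ) (hk : k ≠ 0)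
    (h : σ.tri c = τ.tri d) : σ = τ := by
  obtain rfl := hσ.eq_of_tri_eq hτ h
  have hadd {c : Color} (h : σ.tri c = τ.tri c) : σ.tri (c + k) = τ.tri (c + k) :=
    (h ▸ hσ.matches_add hk c).triangle_eq (hτ.matches_add hk c)
  have hcases : ∀ k c d : Color, k ≠ 0 → d = c ∨ d = c + k ∨ d = c + k + k := by decide
  ext d
  rcases hcases k c d hk with rfl | rfl | rfl
  exacts [h, hadd h, hadd (hadd h)]

theorem exists_move (h : IsPosition k s σ) (hk : k ≠ 0) : ∃ t, IsMove k (k + k) σ s t := by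
  let ι : Color ↪ {w : W // w ≠ T.outer} :=
    ⟨fun c => ⟨σ.tri c, (h c).ne_outer⟩, fun c d hcd => h.tri_injective (congrArg Subtype.val hcd)⟩
  let p := (Equiv.addRight k : Equiv.Perm Color).viaEmbedding ι
  have hp_tri (c : Color) : p (ι c) = ι (c + k) := Equiv.Perm.viaEmbedding_apply _ _ _
  have hp_of_ne (w) (hw : ∀ c, w.1 ≠ σ.tri c) : p w = w :=
    Equiv.Perm.viaEmbedding_apply_of_notMem _ _ _ fun ⟨c, hc⟩ => hw c (congrArg Subtype.val hc).symm
  obtain ⟨t, ht⟩ := s.exists_of_perm p fun w => by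
    by_cases hw : ∃ c, w = ι c
    · obtain ⟨c, rfl⟩ := hw
      rw [hp_tri]
      exact ⟨_, (h.matches_add hk c).2⟩
    · rw [hp_of_ne w fun c hc => hw ⟨c, Subtype.ext hc⟩]
      exact s.incident w
  have hmatches (w) (hw : ∀ c, w ≠ σ.tri c) (v) (hv : s.Matches w v) : t.Matches w v :=
    ht ⟨w, hv.ne_outer⟩ v (by rwa [hp_of_ne ⟨w, hv.ne_outer⟩ hw])
  refine ⟨t, h, fun c => ht (ι c) _ ?_, fun w hw v => ⟨hmatches w hw v, fun hv => ?_⟩⟩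
  · rw [hp_tri]
    exact h.matches_add hk c
  · have hs := s.matches_color hv.ne_outer
    rwa [hv.vertex_eq (hmatches w hw _ hs)]

end IsPosition

namespace IsMove

theorem symm (h : IsMove k l σ s t) : IsMove l k σ t s :=
  ⟨h.target, h.source, fun w hw v => (h.matches_iff w hw v).symm⟩

theorem target_eq (h : IsMove k l σ s t) (h' : IsMove k l σ s u) : t = u :=
  State.ext_matches fun w v hv => by
    by_cases hw : ∃ c, w = σ.tri c
    · obtain ⟨c, rfl⟩ := hw
      exact hv.vertex_eq (h.target c) ▸ h'.target c
    · push Not at hw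
      exact (h'.matches_iff w hw v).1 ((h.matches_iff w hw v).2 hv)

theorem exists_join (hσ : IsMove k (k + k) σ s t) (hτ : IsMove k (k + k) τ s u) (hk : k ≠ 0)
    (hne : σ ≠ τ) : ∃ v, IsMove k (k + k) τ t v ∧ IsMove k (k + k) σ u v := by
  have hdisj (c d : Color) : σ.tri c ≠ τ.tri d := fun h => hne (hσ.source.site_eq hτ.source hk h)
  have hpos : IsPosition k t τ := fun c =>
    (hσ.matches_iff _ (fun d => (hdisj d c).symm) _).1 (hτ.source c)
  obtain ⟨v, hv⟩ := hpos.exists_move hk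
  refine ⟨v, hv, fun c => (hτ.matches_iff _ (hdisj c) _).1 (hσ.source c),
    fun c => (hv.matches_iff _ (hdisj c) _).1 (hσ.target c), fun w hw x => ?_⟩
  by_cases hwτ : ∃ c, w = τ.tri c
  · obtain ⟨c, rfl⟩ := hwτ
    exact ⟨fun hx => hx.vertex_eq (hτ.target c) ▸ hv.target c,
      fun hx => hx.vertex_eq (hv.target c) ▸ hτ.target c⟩
  · push Not at hwτ
    rw [← hτ.matches_iff w hwτ, hσ.matches_iff w hw, hv.matches_iff w hwτ]

end IsMove

theorem isCommuting_isMove (T : PlanarTrinity W B) (hk : k ≠ 0) :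
    IsCommuting fun σ : T.Site => IsMove k (k + k) σ :=
  ⟨IsMove.target_eq, fun hσ hτ => hσ.exists_join hτ hk⟩

theorem isCommuting_clockwiseMove (T : PlanarTrinity W B) : IsCommuting T.ClockwiseMove := by
  have heq : T.ClockwiseMove = fun σ => IsMove 1 (1 + 1) σ := by
    ext σ s t
    exact clockwiseMove_iff
  exact heq ▸ T.isCommuting_isMove one_ne_zero

theorem isCommuting_flip_clockwiseMove (T : PlanarTrinity W B) :
    IsCommuting fun σ => flip (T.ClockwiseMove σ) := by
  have heq : (fun σ => flip (T.ClockwiseMove σ)) = fun σ => IsMove 2 (2 + 2) σ := by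
    ext σ s t
    exact clockwiseMove_iff.trans ⟨IsMove.symm, IsMove.symm⟩
  exact heq ▸ T.isCommuting_isMove Color.two_ne_zero

open Classical in
/-- The three white triangles of a site. -/
noncomputable def Site.triangles (σ : T.Site) : Finset W := Finset.univ.image σ.tri

theorem Site.mem_triangles : w ∈ σ.triangles ↔ ∃ c, σ.tri c = w := by
  simp [Site.triangles]

theorem IsPosition.isTurn (h : IsPosition 1 s σ) :
    IsTurn s σ.triangles (fun w => σ.tri (s.color w)) where
  nonempty := ⟨σ.tri 0, Site.mem_triangles.2 ⟨0, rfl⟩⟩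
  mapsTo _ _ := Site.mem_triangles.2 ⟨_, rfl⟩
  matches_vertex w hw := by
    obtain ⟨c, rfl⟩ := Site.mem_triangles.1 hw
    simpa only [h.color_tri, add_assoc] using h.matches_add one_ne_zero c
  trans w hw w' hw' := by
    obtain ⟨c, rfl⟩ := Site.mem_triangles.1 hw
    obtain ⟨d, rfl⟩ := Site.mem_triangles.1 hw'
    rcases Color.eq_or_eq_add_one_or_eq_add_two c d with rfl | rfl | rfl
    · exact ⟨0, rfl⟩
    · exact ⟨1, by simp [h.color_tri]⟩
    · exact ⟨2, by simp [h.color_tri]⟩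

theorem IsMove.chain_sub_chain (h : IsMove 1 2 σ s t) :
    t.chain - s.chain = s.shiftChain σ.triangles := by
  ext ⟨w, c⟩
  rw [Pi.sub_apply, State.shiftChain]
  by_cases hw : w ∈ σ.triangles
  · obtain ⟨d, rfl⟩ := Site.mem_triangles.1 hw
    simp [hw, State.chain_apply_color _ (h.source d).ne_outer, h.source.color_tri,
      h.target.color_tri, eq_comm]
  · simp only [hw, if_false, State.chain]
    rw [h.matches_iff w fun c hc => hw (Site.mem_triangles.2 ⟨c, hc.symm⟩), sub_self]

theorem IsMove.exists_isHeight [Finite W] (hm : IsMove 1 2 σ s t) :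
    ∃ h : B → ℚ, IsHeight s t h ∧ (∀ b, h b = 0 ∨ h b = 1) ∧
      T.IsRegion {b | h b = 1} σ.triangles s.color (fun w => σ.tri (s.color w)) := by
  have hK := hm.source.isTurn
  obtain ⟨h, hh⟩ := PlanarTrinity.exists_isHeight s t
  have hshift : T.boundary h = s.shiftChain σ.triangles := hh.boundary_eq.trans hm.chain_sub_chain
  obtain ⟨w₀, hw₀⟩ := hK.nonempty
  have hD := hK.isRegion hshift hw₀
  set m := h (T.glue (s.color w₀ + 2) w₀)
  have hmem (w) (hw : w ∈ σ.triangles) (c) : h (T.glue c w) = m - 1 ∨ h (T.glue c w) = m := by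
    have hlow := IsTurn.apply_glue_of_mem hshift hw
    have htop := hK.apply_eq hshift hw₀ hw
    rw [← htop] at hlow
    rcases Color.eq_or_eq_add_one_or_eq_add_two (s.color w) c with rfl | rfl | rfl
    exacts [Or.inl hlow.1, Or.inl hlow.2, Or.inr htop.symm]
  have hvalues (w) : ∀ c, h (T.glue c w) = m - 1 ∨ h (T.glue c w) = m := by
    refine T.connected.induction (p := fun w => ∀ c, h (T.glue c w) = m - 1 ∨ h (T.glue c w) = m)
      (fun b c d hc e => ?_) (hmem w₀ hw₀) w
    by_cases hu : (T.glue d).symm b ∈ σ.triangles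
    · exact hmem _ hu e
    · rw [IsTurn.apply_glue_of_notMem hshift hu e d, Equiv.apply_symm_apply]
      simpa using hc c
  have hm1 : m = 1 := by
    have houter := (hvalues T.outer 0).resolve_right fun h => hK.outer_notMem hD ⟨0, h⟩
    linarith [hh.outer]
  rw [hm1] at hvalues hD
  exact ⟨h, hh, fun b => by simpa using hvalues ((T.glue 0).symm b) 0, hD⟩

/-! ### The existence of moves -/

theorem IsTurn.surjOn_color {K : Finset W} {f : W → W} (hK : IsTurn s K f) :
    Set.SurjOn s.color K Set.univ := by
  intro c _
  obtain ⟨w, hw⟩ := hK.nonempty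
  rcases Color.eq_or_eq_add_one_or_eq_add_two (s.color w) c with rfl | rfl | rfl
  · exact ⟨w, hw, rfl⟩
  · exact ⟨f w, hK.mapsTo hw, hK.color_apply hw⟩
  · exact ⟨f (f w), hK.mapsTo (hK.mapsTo hw), by
      rw [hK.color_apply (hK.mapsTo hw), hK.color_apply hw, Color.add_one_add_one]⟩

theorem IsTurn.injOn_color [Finite W] {K : Finset W} {f : W → W} (hK : IsTurn s K f) :
    Set.InjOn s.color K :=
  Finset.injOn_of_surjOn_of_card_le (t := Finset.univ) s.color (fun _ _ => Finset.mem_univ _)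
    (by simpa using hK.surjOn_color) hK.card_le

theorem IsTurn.exists_isPosition [Finite W] {K : Finset W} {f : W → W} (hK : IsTurn s K f) :
    ∃ σ, IsPosition 1 s σ := by
  choose tri htri hcolor using fun c : Color => hK.surjOn_color (Set.mem_univ (c + 1))
  have hf (c : Color) : f (tri c) = tri (c + 1) :=
    hK.injOn_color (hK.mapsTo (htri c)) (htri _) (by rw [hK.color_apply (htri c), hcolor, hcolor])
  refine ⟨⟨tri, fun c => ?_⟩, fun c => hcolor c ▸ s.matches_color (hK.ne_outer (htri c))⟩
  have hvertex := hK.vertex_eq (htri (c + 1))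
  rw [hf, hcolor, hcolor, add_assoc (c + 1), one_add_one_eq_two, Color.add_one_add_two,
    Color.add_one_add_one] at hvertex
  exact hvertex.symm

namespace IsHeight

variable [Finite W] {h : B → ℚ} {b : B}

theorem le_glue_add_two (hh : IsHeight s t h) (hw : s.Matches w (T.vertex c w))
    (hb : T.blackVertex c b = T.vertex c w) : h b ≤ h (T.glue (c + 2) w) := by
  refine Gluing.le_of_boundary_nonneg (fun u hu huw => ?_) hb
  have hs : s.chain (u, c) = 0 := if_neg fun h => huw ((hu ▸ h).triangle_eq hw)
  rw [hh.boundary_eq, Pi.sub_apply, hs, sub_zero, State.chain]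
  split_ifs <;> norm_num

theorem exists_matches_blackVertex (hh : IsHeight s t h) (hpos : 0 < h b)
    (hmax : ∀ b', h b' ≤ h b) (c : Color) :
    ∃ w, s.Matches w (T.blackVertex c b) ∧ h (T.glue (s.color w + 2) w) = h b := by
  obtain ⟨w, hw⟩ := s.exists_matches (v := T.blackVertex c b) fun d hd => by
    obtain rfl : c = d := T.color_eq_of_vertex_eq hd
    exact hpos.ne' (hh.eq_zero_of_blackVertex_eq_root hd)
  have hbw : T.blackVertex c b = T.vertex (s.color w) w := hw.eq_vertex_color
  obtain rfl : c = s.color w := T.color_eq_of_vertex_eq hbw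
  exact ⟨w, hw, (hmax _).antisymm (hh.le_glue_add_two (hbw ▸ hw) hbw)⟩

theorem exists_isTurn (hh : IsHeight s t h) (hb : 0 < h b) : ∃ K f, IsTurn s K f := by
  have : Finite B := Finite.of_equiv W (T.glue 0)
  have : Nonempty B := ⟨b⟩
  obtain ⟨m, hm⟩ := Finite.exists_max h
  have hpos : 0 < h m := hb.trans_le (hm b)
  let S : Set W := {w | h (T.glue (s.color w + 2) w) = h m}
  have hnext (w : W) (hw : w ∈ S) : ∃ w' ∈ S, s.Matches w' (T.vertex (s.color w + 1) w) := by
    obtain ⟨w', hw', hw'S⟩ := hh.exists_matches_blackVertex (b := T.glue (s.color w + 2) w)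
      (hpos.trans_eq hw.symm) (fun b' => (hm b').trans_eq hw.symm) (s.color w + 1)
    rw [T.blackVertex_glue (by simp)] at hw'
    exact ⟨w', hw'S.trans hw, hw'⟩
  choose! f hfS hf using hnext
  obtain ⟨w₀, -, hw₀⟩ := hh.exists_matches_blackVertex hpos hm 0
  obtain ⟨K, hKS, hK, hfK, htrans⟩ := exists_finset_mapsTo_of_mapsTo hfS ⟨w₀, hw₀⟩
  exact ⟨K, f, hK, hfK, fun w hw => hf w (hKS hw), htrans⟩

theorem exists_move (hh : IsHeight s t h) (hb : 0 < h b) : ∃ σ u, T.ClockwiseMove σ s u := by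
  obtain ⟨K, f, hK⟩ := hh.exists_isTurn hb
  obtain ⟨σ, hσ⟩ := hK.exists_isPosition
  obtain ⟨u, hu⟩ := hσ.exists_move one_ne_zero
  exact ⟨σ, u, clockwiseMove_iff.2 hu⟩

end IsHeight

theorem eq_of_isSink [Finite W] (hs : IsSink T.ClockwiseMove s) (ht : IsSink T.ClockwiseMove t) :
    s = t := by
  obtain ⟨h, hh⟩ := exists_isHeight s t
  obtain rfl : h = 0 := by
    ext b
    refine le_antisymm (not_lt.1 fun hb => ?_) (not_lt.1 fun hb => ?_)
    · obtain ⟨σ, u, hu⟩ := hh.exists_move hb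
      exact hs σ u hu
    · obtain ⟨σ, u, hu⟩ := hh.neg.exists_move (neg_pos.2 hb)
      exact ht σ u hu
  exact hh.eq_of_eq_zero

theorem exists_lt_of_clockwiseMove [Finite W] (T : PlanarTrinity W B) :
    ∃ r : T.State → ℚ, ∀ σ s t, T.ClockwiseMove σ s t → r s < r t := by
  rcases isEmpty_or_nonempty T.State with hE | ⟨⟨s₀⟩⟩
  · exact ⟨fun _ => 0, fun _ s => hE.elim s⟩
  have : Finite B := Finite.of_equiv W (T.glue 0)
  have := Fintype.ofFinite B
  choose H hH using fun s => exists_isHeight s₀ s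
  refine ⟨fun s => ∑ b, H s b, fun σ s t hm => ?_⟩
  obtain ⟨h, hh, h01, hD⟩ := (clockwiseMove_iff.1 hm).exists_isHeight
  obtain ⟨b, hb : h b = 1⟩ : ∃ b, h b = 1 :=
    ⟨_, (hD.glue_mem_iff (σ.tri 0) (Site.mem_triangles.2 ⟨0, rfl⟩) _).2 rfl⟩
  simp only [(hH t).unique ((hH s).add hh), Pi.add_apply]
  refine Finset.sum_lt_sum (fun b _ => ?_) ⟨b, Finset.mem_univ b, by simp [hb]⟩
  rcases h01 b with h0 | h0 <;> simp [h0]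

end PlanarTrinity

namespace PlanarTrinity

variable {W B : Type*} (T : PlanarTrinity W B) (c : Color)

/-! ### The greedy search -/

/-- The position of the greedy search of colour `c` after `k` steps. -/
noncomputable def clockedPos (k : ℕ) : W ⊕ B := ((T.clockedStep c)^[k] (Sum.inl T.outer, ∅)).1

/-- The arrows that the greedy search of colour `c` has selected after `k` steps. -/
noncomputable def clockedSet (k : ℕ) : Set W := ((T.clockedStep c)^[k] (Sum.inl T.outer, ∅)).2

/-- The vertex of colour `c` about which the greedy search turns at a given position. -/
def center : W ⊕ B → T.Vertex := Sum.elim (T.vertex c) (T.blackVertex c)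

/-- The vertex `v` counts as reached when the arrows of colour `c` across `A` are selected: it is
the root or the head of one of them. -/
def Reached (A : Set W) (v : T.Vertex) : Prop := v = T.root c ∨ ∃ a ∈ A, T.vertex c a = v

/-- An arrow of colour `c` across a triangle in `A` leads from `x` to `y`. -/
def SelectedArrow (A : Set W) (x y : T.Vertex) : Prop :=
  ∃ w ∈ A, T.arrowTail c w = x ∧ T.arrowHead c w = y

variable {T c} {k l K : ℕ} {a u w : W} {v x y z : T.Vertex} {A A' : Set W}

theorem clocked_succ (k : ℕ) : (T.clockedPos c (k + 1), T.clockedSet c (k + 1)) =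
    T.clockedStep c (T.clockedPos c k, T.clockedSet c k) :=
  Function.iterate_succ_apply' _ _ _

theorem clocked_succ_of_mem (hp : T.clockedPos c k = Sum.inl w) (hw : w ∈ T.clockedSet c k) :
    T.clockedPos c (k + 1) = Sum.inl ((T.glue (c + 1)).symm (T.glue c w)) ∧
      T.clockedSet c (k + 1) = T.clockedSet c k := by
  have h := clocked_succ (T := T) (c := c) k
  rwa [hp, clockedStep, if_pos hw, Prod.mk.injEq] at h

theorem clocked_succ_of_notMem (hp : T.clockedPos c k = Sum.inl w) (hw : w ∉ T.clockedSet c k) :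
    T.clockedPos c (k + 1) = Sum.inr (T.glue (c + 2) w) ∧
      T.clockedSet c (k + 1) = T.clockedSet c k := by
  have h := clocked_succ (T := T) (c := c) k
  rwa [hp, clockedStep, if_neg hw, Prod.mk.injEq] at h

theorem clocked_succ_of_reached (hp : T.clockedPos c k = Sum.inr (T.glue c a))
    (ha : T.Reached c (T.clockedSet c k) (T.vertex c a)) :
    T.clockedPos c (k + 1) = Sum.inl ((T.glue (c + 1)).symm (T.glue c a)) ∧
      T.clockedSet c (k + 1) = T.clockedSet c k := by
  have h := clocked_succ (T := T) (c := c) k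
  rw [hp, clockedStep, Equiv.symm_apply_apply] at h
  exact Prod.mk.inj (h.trans (if_pos ha))

theorem clocked_succ_of_not_reached (hp : T.clockedPos c k = Sum.inr (T.glue c a))
    (ha : ¬ T.Reached c (T.clockedSet c k) (T.vertex c a)) :
    T.clockedPos c (k + 1) = Sum.inr (T.glue (c + 2) a) ∧
      T.clockedSet c (k + 1) = insert a (T.clockedSet c k) := by
  have h := clocked_succ (T := T) (c := c) k
  rw [hp, clockedStep, Equiv.symm_apply_apply] at h
  exact Prod.mk.inj (h.trans (if_neg ha))

variable (T c) in
theorem clocked_cases (k : ℕ) :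
    (∃ w, T.clockedPos c k = Sum.inl w ∧ w ∈ T.clockedSet c k) ∨
    (∃ w, T.clockedPos c k = Sum.inl w ∧ w ∉ T.clockedSet c k) ∨
    (∃ a, T.clockedPos c k = Sum.inr (T.glue c a) ∧
      T.Reached c (T.clockedSet c k) (T.vertex c a)) ∨
    ∃ a, T.clockedPos c k = Sum.inr (T.glue c a) ∧
      ¬ T.Reached c (T.clockedSet c k) (T.vertex c a) := by
  rcases hp : T.clockedPos c k with w | b
  · by_cases hw : w ∈ T.clockedSet c k
    exacts [.inl ⟨w, rfl, hw⟩, .inr (.inl ⟨w, rfl, hw⟩)]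
  · obtain ⟨a, rfl⟩ := (T.glue c).surjective b
    by_cases ha : T.Reached c (T.clockedSet c k) (T.vertex c a)
    exacts [.inr (.inr (.inl ⟨a, rfl, ha⟩)), .inr (.inr (.inr ⟨a, rfl, ha⟩))]

theorem clockedSet_mono : Monotone (T.clockedSet c) := by
  refine monotone_nat_of_le_succ fun k => ?_
  rcases T.clocked_cases c k with ⟨w, hp, hw⟩ | ⟨w, hp, hw⟩ | ⟨a, hp, ha⟩ | ⟨a, hp, ha⟩
  · exact (clocked_succ_of_mem hp hw).2.ge
  · exact (clocked_succ_of_notMem hp hw).2.ge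
  · exact (clocked_succ_of_reached hp ha).2.ge
  · exact (clocked_succ_of_not_reached hp ha).2 ▸ Set.subset_insert _ _

theorem exists_not_reached_of_mem (ha : a ∈ T.clockedSet c k) :
    ∃ j < k, T.clockedPos c j = Sum.inr (T.glue c a) ∧
      ¬ T.Reached c (T.clockedSet c j) (T.vertex c a) := by
  induction k with
  | zero => exact ha.elim
  | succ k ih =>
    have hold : a ∈ T.clockedSet c k → ∃ j < k + 1, T.clockedPos c j = Sum.inr (T.glue c a) ∧
        ¬ T.Reached c (T.clockedSet c j) (T.vertex c a) := fun h =>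
      let ⟨j, hj, h⟩ := ih h
      ⟨j, hj.trans k.lt_succ_self, h⟩
    rcases T.clocked_cases c k with ⟨w, hp, hw⟩ | ⟨w, hp, hw⟩ | ⟨b, hp, hb⟩ | ⟨b, hp, hb⟩
    · exact hold ((clocked_succ_of_mem hp hw).2 ▸ ha)
    · exact hold ((clocked_succ_of_notMem hp hw).2 ▸ ha)
    · exact hold ((clocked_succ_of_reached hp hb).2 ▸ ha)
    · rw [(clocked_succ_of_not_reached hp hb).2] at ha
      rcases ha with rfl | ha
      exacts [⟨k, k.lt_succ_self, hp, hb⟩, hold ha]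

theorem mem_clockedSet_succ (hp : T.clockedPos c k = Sum.inr (T.glue c a))
    (ha : ¬ T.Reached c (T.clockedSet c k) (T.vertex c a)) : a ∈ T.clockedSet c (k + 1) :=
  (clocked_succ_of_not_reached hp ha).2 ▸ Set.mem_insert _ _

theorem clockedSet_subset (k : ℕ) : T.clockedSet c k ⊆ T.clockedArborescence c :=
  fun _ hw => ⟨k, hw⟩

theorem Reached.mono (hA : A ⊆ A') (h : T.Reached c A v) : T.Reached c A' v :=
  h.imp_right fun ⟨a, ha, h⟩ => ⟨a, hA ha, h⟩

theorem SelectedArrow.mono (hA : A ⊆ A') (h : T.SelectedArrow c A x y) :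
    T.SelectedArrow c A' x y :=
  let ⟨w, hw, h⟩ := h
  ⟨w, hA hw, h⟩

theorem reflTransGen_selectedArrow_mono (hA : A ⊆ A')
    (h : Relation.ReflTransGen (T.SelectedArrow c A) x y) :
    Relation.ReflTransGen (T.SelectedArrow c A') x y :=
  Relation.ReflTransGen.mono (fun _ _ => SelectedArrow.mono hA) _ _ h

theorem vertex_ne_root_of_mem (ha : a ∈ T.clockedArborescence c) : T.vertex c a ≠ T.root c := by
  obtain ⟨k, hk⟩ := ha
  obtain ⟨j, -, -, h⟩ := exists_not_reached_of_mem hk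
  exact fun hr => h (.inl hr)

theorem outer_notMem_clockedArborescence : T.outer ∉ T.clockedArborescence c :=
  fun h => vertex_ne_root_of_mem h rfl

theorem mem_clockedSet_of_reached (hr : T.Reached c (T.clockedSet c k) (T.vertex c w))
    (hw : w ∈ T.clockedArborescence c) : w ∈ T.clockedSet c k := by
  obtain ⟨l, hl⟩ := hw
  obtain ⟨j, -, hp, hj⟩ := exists_not_reached_of_mem hl
  have hjk : j < k := not_le.1 fun hkj => hj (hr.mono (clockedSet_mono hkj))
  exact clockedSet_mono hjk (mem_clockedSet_succ hp hj)

theorem eq_of_vertex_eq (ha : a ∈ T.clockedArborescence c) (hw : w ∈ T.clockedArborescence c)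
    (h : T.vertex c a = T.vertex c w) : a = w := by
  obtain ⟨k, hk⟩ := ha
  obtain ⟨i, -, hi, hi'⟩ := exists_not_reached_of_mem hk
  obtain ⟨l, hl⟩ := hw
  obtain ⟨j, -, hj, hj'⟩ := exists_not_reached_of_mem hl
  rcases lt_trichotomy i j with hij | rfl | hij
  · exact (hj' (.inr ⟨a, clockedSet_mono hij (mem_clockedSet_succ hi hi'), h⟩)).elim
  · exact (T.glue c).injective (Sum.inr_injective (hi.symm.trans hj))
  · exact (hi' (.inr ⟨w, clockedSet_mono hij (mem_clockedSet_succ hj hj'), h.symm⟩)).elim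

theorem SelectedArrow.ne_root (h : T.SelectedArrow c (T.clockedSet c k) x y) :
    y ≠ T.root c := by
  obtain ⟨w, hw, -, rfl⟩ := h
  exact vertex_ne_root_of_mem ⟨k, hw⟩

theorem SelectedArrow.tail_eq (h : T.SelectedArrow c (T.clockedSet c k) x y)
    (h' : T.SelectedArrow c (T.clockedSet c k) z y) : x = z := by
  obtain ⟨w, hw, rfl, rfl⟩ := h
  obtain ⟨w', hw', rfl, h⟩ := h'
  rw [eq_of_vertex_eq ⟨k, hw⟩ ⟨k, hw'⟩ h.symm]

variable (T c) in
theorem center_succ (k : ℕ) :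
    T.center c (T.clockedPos c (k + 1)) = T.center c (T.clockedPos c k) ∨
    (∃ w ∈ T.clockedSet c k, T.clockedPos c k = Sum.inl w ∧
      T.center c (T.clockedPos c (k + 1)) = T.arrowTail c w) ∨
    T.SelectedArrow c (T.clockedSet c (k + 1)) (T.center c (T.clockedPos c k))
      (T.center c (T.clockedPos c (k + 1))) := by
  have hturn (w : W) : T.blackVertex c (T.glue (c + 2) w) = T.vertex c w :=
    T.blackVertex_glue (by simp) w
  rcases T.clocked_cases c k with ⟨w, hp, hw⟩ | ⟨w, hp, hw⟩ | ⟨a, hp, ha⟩ | ⟨a, hp, ha⟩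
  · exact .inr (.inl ⟨w, hw, hp, by rw [(clocked_succ_of_mem hp hw).1]; rfl⟩)
  · rw [(clocked_succ_of_notMem hp hw).1, hp]
    exact .inl (hturn w)
  · rw [(clocked_succ_of_reached hp ha).1, hp]
    exact .inl rfl
  · have hmem := mem_clockedSet_succ hp ha
    rw [(clocked_succ_of_not_reached hp ha).1, hp]
    exact .inr (.inr ⟨a, hmem, rfl, (hturn a).symm⟩)

theorem reached_center (k : ℕ) :
    T.Reached c (T.clockedSet c k) (T.center c (T.clockedPos c k)) := by
  induction k using Nat.strong_induction_on with
  | _ k ih =>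
    cases k with
    | zero => exact .inl rfl
    | succ k =>
      rcases T.center_succ c k with h | ⟨w, hw, -, h⟩ | ⟨w, hw, -, h⟩
      · exact h ▸ (ih k k.lt_succ_self).mono (clockedSet_mono k.le_succ)
      · obtain ⟨j, hj, hp, -⟩ := exists_not_reached_of_mem hw
        have := ih j (hj.trans k.lt_succ_self)
        rw [hp] at this
        exact h ▸ this.mono (clockedSet_mono (hj.le.trans k.le_succ))
      · exact .inr ⟨w, hw, h⟩

theorem reached_arrowTail (ha : a ∈ T.clockedSet c k) :
    ∃ j < k, T.Reached c (T.clockedSet c j) (T.arrowTail c a) := by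
  obtain ⟨j, hj, hp, -⟩ := exists_not_reached_of_mem ha
  have := reached_center (T := T) (c := c) j
  rw [hp] at this
  exact ⟨j, hj, this⟩

theorem Reached.reflTransGen (hv : T.Reached c (T.clockedSet c k) v) :
    Relation.ReflTransGen (T.SelectedArrow c (T.clockedSet c k)) (T.root c) v := by
  induction k using Nat.strong_induction_on generalizing v with
  | _ k ih =>
    rcases hv with rfl | ⟨a, ha, rfl⟩
    · exact .refl
    · obtain ⟨j, hj, hr⟩ := reached_arrowTail ha
      exact (reflTransGen_selectedArrow_mono (clockedSet_mono hj.le) (ih j hj hr)).tail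
        ⟨a, ha, rfl, rfl⟩

theorem not_transGen_selectedArrow_self (hv : T.Reached c (T.clockedSet c k) v) :
    ¬ Relation.TransGen (T.SelectedArrow c (T.clockedSet c k)) v v := by
  induction hv.reflTransGen with
  | refl =>
    intro h
    obtain ⟨x, -, hx⟩ := Relation.TransGen.tail'_iff.1 h
    exact hx.ne_root rfl
  | tail _ hxy ih =>
    intro h
    obtain ⟨z, hz, hzy⟩ := Relation.TransGen.tail'_iff.1 h
    rw [hzy.tail_eq hxy] at hz
    obtain ⟨w, hw, rfl, -⟩ := id hxy
    obtain ⟨j, hj, hr⟩ := reached_arrowTail hw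
    exact ih (hr.mono (clockedSet_mono hj.le)) (.head' hxy hz)

/-- Since each arrow is followed back only after the full turn about its head, the search stays
among the descendants of the head until it meets the terminal end of the arrow. -/
theorem exists_clockedPos_eq_or_reflTransGen (ha : a ∈ T.clockedSet c k) :
    (∃ j < k, T.clockedPos c j = Sum.inl a) ∨
      Relation.ReflTransGen (T.SelectedArrow c (T.clockedSet c k)) (T.vertex c a)
        (T.center c (T.clockedPos c k)) := by
  obtain ⟨i, hik, hp, hi⟩ := exists_not_reached_of_mem ha
  clear ha
  induction k, hik using Nat.le_induction with
  | base =>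
    rw [(clocked_succ_of_not_reached hp hi).1]
    have hcenter : T.blackVertex c (T.glue (c + 2) a) = T.vertex c a :=
      T.blackVertex_glue (by simp) a
    exact .inr (hcenter ▸ .refl)
  | succ k _ ih =>
    rcases ih with ⟨j, hj, h⟩ | hanc
    · exact .inl ⟨j, hj.trans k.lt_succ_self, h⟩
    have hanc' := reflTransGen_selectedArrow_mono (clockedSet_mono k.le_succ) hanc
    rcases T.center_succ c k with h | ⟨w, hw, hpw, h⟩ | h
    · exact .inr (h ▸ hanc')
    · rw [hpw] at hanc
      rcases hanc.cases_tail with heq | ⟨y, hay, hyw⟩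
      · rw [← eq_of_vertex_eq ⟨k, hw⟩ ⟨_, mem_clockedSet_succ hp hi⟩ heq]
        exact .inl ⟨k, k.lt_succ_self, hpw⟩
      · rw [h, ← hyw.tail_eq ⟨w, hw, rfl, rfl⟩]
        exact .inr (reflTransGen_selectedArrow_mono (clockedSet_mono k.le_succ) hay)
    · exact .inr (hanc'.tail h)

theorem exists_lt_clockedPos_eq (hp : T.clockedPos c k = Sum.inr (T.glue c a))
    (ha : a ∈ T.clockedSet c k) : ∃ j < k, T.clockedPos c j = Sum.inl a := by
  refine (exists_clockedPos_eq_or_reflTransGen ha).resolve_right fun h => ?_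
  rw [hp] at h
  exact not_transGen_selectedArrow_self (.inr ⟨a, ha, rfl⟩) (.tail' h ⟨a, ha, rfl, rfl⟩)

/-! ### The search visits every triangle -/

theorem exists_clockedPos_eq_glue_of_mem (ha : a ∈ T.clockedArborescence c) :
    ∃ j, T.clockedPos c j = Sum.inr (T.glue c a) ∧
      T.clockedPos c (j + 1) = Sum.inr (T.glue (c + 2) a) := by
  obtain ⟨k, hk⟩ := ha
  obtain ⟨j, -, hp, hj⟩ := exists_not_reached_of_mem hk
  exact ⟨j, hp, (clocked_succ_of_not_reached hp hj).1⟩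

theorem exists_clockedPos_eq_inr_of_eq_inl (hw : w ≠ T.outer)
    (hp : T.clockedPos c k = Sum.inl w) :
    ∃ j, T.clockedPos c j = Sum.inr (T.glue (c + 1) w) := by
  cases k with
  | zero => exact absurd (Sum.inl_injective hp).symm hw
  | succ k =>
    rcases T.clocked_cases c k with ⟨u, hu, h⟩ | ⟨u, hu, h⟩ | ⟨u, hu, h⟩ | ⟨u, hu, h⟩
    · rw [Sum.inl_injective (hp.symm.trans (clocked_succ_of_mem hu h).1), Equiv.apply_symm_apply]
      obtain ⟨j, hj, -⟩ := exists_clockedPos_eq_glue_of_mem ⟨k, h⟩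
      exact ⟨j, hj⟩
    · cases hp.symm.trans (clocked_succ_of_notMem hu h).1
    · rw [Sum.inl_injective (hp.symm.trans (clocked_succ_of_reached hu h).1),
        Equiv.apply_symm_apply]
      exact ⟨k, hu⟩
    · cases hp.symm.trans (clocked_succ_of_not_reached hu h).1

theorem clockedPos_succ_of_clockedSet_eq (hk : T.clockedSet c k = T.clockedArborescence c)
    (hk' : T.clockedSet c (k + 1) = T.clockedArborescence c) {b : B}
    (hp : T.clockedPos c k = Sum.inr b) :
    T.clockedPos c (k + 1) = Sum.inl ((T.glue (c + 1)).symm b) := by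
  obtain ⟨a, rfl⟩ := (T.glue c).surjective b
  by_cases ha : T.Reached c (T.clockedSet c k) (T.vertex c a)
  · exact (clocked_succ_of_reached hp ha).1
  · exact absurd (.inr ⟨a, (hk'.trans hk.symm).le (mem_clockedSet_succ hp ha), rfl⟩) ha

theorem exists_clockedPos_eq_of_pow_rot
    (hK : ∀ k, K ≤ k → T.clockedSet c k = T.clockedArborescence c)
    (hu : ∀ a ∈ T.clockedArborescence c, T.vertex c a = T.vertex c u → a = u) (i : ℕ)
    (hk : K ≤ k) (hp : T.clockedPos c k = Sum.inl w) (hi : (T.rot c ^ i) w = u) :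
    ∃ j, k ≤ j ∧ T.clockedPos c j = Sum.inl u := by
  induction i generalizing k w with
  | zero => exact ⟨k, le_rfl, hi ▸ hp⟩
  | succ i ih =>
    by_cases hw : w ∈ T.clockedArborescence c
    · have hwu : T.vertex c w = T.vertex c u := T.vertex_eq_iff.2 ⟨i + 1, mod_cast hi⟩
      exact ⟨k, le_rfl, hu w hw hwu ▸ hp⟩
    · have hp₁ := (clocked_succ_of_notMem hp (hK k hk ▸ hw)).1
      have hp₂ := clockedPos_succ_of_clockedSet_eq (hK _ (by omega)) (hK _ (by omega)) hp₁
      rw [← T.glue_rot, Equiv.symm_apply_apply] at hp₂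
      obtain ⟨j, hj, h⟩ := ih (k := k + 2) (by omega) hp₂ hi
      exact ⟨j, by omega, h⟩

section Finite

variable [Finite W]

/-- Once nothing is selected any more, the search about a vertex arrives at the arrow that leads
to it, or at any prescribed triangle if there is no such arrow. -/
theorem exists_clockedPos_eq_of_center_eq
    (hK : ∀ k, K ≤ k → T.clockedSet c k = T.clockedArborescence c)
    (hu : ∀ a ∈ T.clockedArborescence c, T.vertex c a = T.vertex c u → a = u)
    (hk : K ≤ k) (hp : T.center c (T.clockedPos c k) = T.vertex c u) :
    ∃ j, k ≤ j ∧ T.clockedPos c j = Sum.inl u := by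
  obtain ⟨l, w, hkl, hl, hw⟩ : ∃ l w, k ≤ l ∧ T.clockedPos c l = Sum.inl w ∧
      T.vertex c w = T.vertex c u := by
    rcases hpk : T.clockedPos c k with w | b <;> rw [hpk] at hp
    · exact ⟨k, w, le_rfl, hpk, hp⟩
    · exact ⟨k + 1, _, k.le_succ,
        clockedPos_succ_of_clockedSet_eq (hK _ hk) (hK _ (by omega)) hpk, hp⟩
  obtain ⟨i, hi⟩ := (T.vertex_eq_iff.1 hw).exists_nat_pow_eq
  obtain ⟨j, hj, h⟩ := exists_clockedPos_eq_of_pow_rot hK hu i (hk.trans hkl) hl hi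
  exact ⟨j, hkl.trans hj, h⟩

theorem exists_center_eq_root
    (hK : ∀ k, K ≤ k → T.clockedSet c k = T.clockedArborescence c) (hk : K ≤ k) :
    ∃ j, k ≤ j ∧ T.center c (T.clockedPos c j) = T.root c := by
  have hpath := (reached_center (T := T) (c := c) k).reflTransGen
  rw [hK k hk] at hpath
  generalize hv : T.center c (T.clockedPos c k) = v at hpath
  induction hpath generalizing k with
  | refl => exact ⟨k, le_rfl, hv⟩
  | tail _ hxy ih =>
    obtain ⟨a, ha, rfl, rfl⟩ := hxy
    obtain ⟨l, hkl, hl⟩ := exists_clockedPos_eq_of_center_eq hK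
      (fun a' ha' h => eq_of_vertex_eq ha' ha h) hk hv
    have hcenter : T.center c (T.clockedPos c (l + 1)) = T.arrowTail c a := by
      rw [(clocked_succ_of_mem hl (hK l (hk.trans hkl) ▸ ha)).1]
      rfl
    obtain ⟨j, hj, h⟩ := ih (k := l + 1) (by omega) hcenter
    exact ⟨j, by omega, h⟩

variable (T c) in
theorem exists_clockedSet_eq : ∃ K, ∀ k, K ≤ k → T.clockedSet c k = T.clockedArborescence c := by
  obtain ⟨K, hK⟩ := WellFoundedGT.monotone_chain_condition ⟨T.clockedSet c, clockedSet_mono⟩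
  have hK' (w : W) (hw : w ∈ T.clockedArborescence c) : w ∈ T.clockedSet c K := by
    obtain ⟨k, hk⟩ := hw
    rcases le_total k K with h | h
    exacts [clockedSet_mono h hk, (hK k h).ge hk]
  exact ⟨K, fun k hk => (clockedSet_subset k).antisymm fun w hw => clockedSet_mono hk (hK' w hw)⟩

theorem exists_clockedPos_eq_of_mem (ha : a ∈ T.clockedArborescence c) :
    ∃ j, T.clockedPos c j = Sum.inl a := by
  obtain ⟨K, hK⟩ := T.exists_clockedSet_eq c
  obtain ⟨k, hk, hroot⟩ := exists_center_eq_root hK le_rfl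
  rcases exists_clockedPos_eq_or_reflTransGen ((hK k hk).ge ha) with ⟨j, -, h⟩ | h
  · exact ⟨j, h⟩
  · rw [hroot] at h
    rcases h.cases_tail with h | ⟨x, -, h⟩
    · exact absurd h.symm (vertex_ne_root_of_mem ha)
    · exact absurd rfl h.ne_root

theorem exists_clockedPos_eq_inl_of_eq_inr
    (hp : T.clockedPos c k = Sum.inr (T.glue (c + 2) w)) : ∃ j, T.clockedPos c j = Sum.inl w := by
  cases k with
  | zero => cases hp
  | succ k =>
    rcases T.clocked_cases c k with ⟨u, hu, h⟩ | ⟨u, hu, h⟩ | ⟨u, hu, h⟩ | ⟨u, hu, h⟩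
    · cases hp.symm.trans (clocked_succ_of_mem hu h).1
    · obtain rfl : w = u := by simpa using hp.symm.trans (clocked_succ_of_notMem hu h).1
      exact ⟨k, hu⟩
    · cases hp.symm.trans (clocked_succ_of_reached hu h).1
    · obtain rfl : w = u := by simpa using hp.symm.trans (clocked_succ_of_not_reached hu h).1
      exact exists_clockedPos_eq_of_mem ⟨k + 1, mem_clockedSet_succ hu h⟩

theorem exists_clockedPos_eq_inl_of_pow_rot (hu : T.vertex c u ≠ T.root c) (i : ℕ)
    (hp : T.clockedPos c k = Sum.inl w) (hi : (T.rot c ^ i) u = w) :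
    ∃ j, T.clockedPos c j = Sum.inl u := by
  induction i generalizing k w with
  | zero => exact ⟨k, hp.trans (congrArg Sum.inl hi.symm)⟩
  | succ i ih =>
    have hw : w ≠ T.outer := fun h =>
      hu (T.vertex_eq_iff.2 ⟨i + 1, mod_cast hi.trans h⟩)
    obtain ⟨l, hl⟩ := exists_clockedPos_eq_inr_of_eq_inl hw hp
    rw [← hi, pow_succ', Equiv.Perm.mul_apply, T.glue_rot] at hl
    obtain ⟨j, hj⟩ := exists_clockedPos_eq_inl_of_eq_inr hl
    exact ih hj rfl

theorem exists_clockedPos_eq_inl_of_reached (hu : T.Reached c (T.clockedSet c k) (T.vertex c u)) :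
    ∃ j, T.clockedPos c j = Sum.inl u := by
  rcases hu with hu | ⟨a, ha, hau⟩
  · obtain ⟨K, hK⟩ := T.exists_clockedSet_eq c
    obtain ⟨l, hl, hroot⟩ := exists_center_eq_root hK le_rfl
    obtain ⟨j, -, hj⟩ := exists_clockedPos_eq_of_center_eq hK
      (fun a ha h => absurd (h.trans hu) (vertex_ne_root_of_mem ha)) hl (hroot.trans hu.symm)
    exact ⟨j, hj⟩
  · have ha : a ∈ T.clockedArborescence c := ⟨k, ha⟩
    obtain ⟨l, hl⟩ := exists_clockedPos_eq_of_mem ha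
    obtain ⟨i, hi⟩ := (T.vertex_eq_iff.1 hau.symm).exists_nat_pow_eq
    exact exists_clockedPos_eq_inl_of_pow_rot (hau ▸ vertex_ne_root_of_mem ha) i hl hi

theorem exists_clockedPos_eq_inr_of_reached {b : B}
    (hb : T.Reached c (T.clockedSet c k) (T.blackVertex c b)) :
    ∃ j, T.clockedPos c j = Sum.inr b := by
  obtain ⟨u, rfl⟩ := (T.glue (c + 2)).surjective b
  rw [T.blackVertex_glue (by simp)] at hb
  by_cases hu : u ∈ T.clockedArborescence c
  · obtain ⟨j, -, hj⟩ := exists_clockedPos_eq_glue_of_mem hu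
    exact ⟨j + 1, hj⟩
  · obtain ⟨j, hj⟩ := exists_clockedPos_eq_inl_of_reached hb
    exact ⟨j + 1, (clocked_succ_of_notMem hj fun h => hu ⟨j, h⟩).1⟩

theorem exists_reached_vertex_of_arrowTail
    (hw : T.Reached c (T.clockedSet c k) (T.arrowTail c w)) :
    ∃ l, T.Reached c (T.clockedSet c l) (T.vertex c w) := by
  obtain ⟨j, hj⟩ := exists_clockedPos_eq_inr_of_reached hw
  by_cases h : T.Reached c (T.clockedSet c j) (T.vertex c w)
  · exact ⟨j, h⟩
  · exact ⟨j + 1, .inr ⟨w, mem_clockedSet_succ hj h, rfl⟩⟩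

variable (T c) in
theorem exists_reached (w : W) : ∃ k, T.Reached c (T.clockedSet c k) (T.vertex c w) := by
  let S : Set W := {w | ∃ k, T.Reached c (T.clockedSet c k) (T.vertex c w)}
  let g : Equiv.Perm W := (T.glue c).trans (T.glue (c + 1)).symm
  -- `g` takes the head of an arrow to its tail, so counting shows that both or none are reached.
  have heq : g ⁻¹' S = S := by
    refine Set.eq_of_subset_of_ncard_le (fun w ⟨k, hk⟩ => exists_reached_vertex_of_arrowTail hk) ?_
    rw [← Set.ncard_image_of_injective (g ⁻¹' S) g.injective, Set.image_preimage_eq _ g.surjective]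
  have hiff (b : B) (d : Color) : (T.glue d).symm b ∈ S ↔
      ∃ k, T.Reached c (T.clockedSet c k) (T.blackVertex c b) := by
    by_cases hd : d = c
    · subst hd
      rw [← heq]
      simp only [Set.mem_preimage, S, g, Set.mem_ofPred_eq, Equiv.trans_apply,
        Equiv.apply_symm_apply]
      rfl
    · simp only [S, Set.mem_ofPred_eq, T.vertex_glue_symm hd]
  exact T.connected.induction (p := (· ∈ S)) (fun b e d h => (hiff b d).2 ((hiff b e).1 h))
    (w := T.outer) ⟨0, .inl rfl⟩ w

variable (T c) in
theorem clockedPos_surjective : Function.Surjective (T.clockedPos c) := by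
  rintro (w | b)
  · obtain ⟨k, hk⟩ := T.exists_reached c w
    exact exists_clockedPos_eq_inl_of_reached hk
  · obtain ⟨k, hk⟩ := T.exists_reached c ((T.glue (c + 1)).symm b)
    exact exists_clockedPos_eq_inr_of_reached hk

variable (T c) in
theorem isSpanningArborescence_clockedArborescence :
    T.IsSpanningArborescence c (T.clockedArborescence c) := by
  obtain ⟨K, hK⟩ := T.exists_clockedSet_eq c
  have hall (v : T.Vertex) (hv : v.1 = c) : T.Reached c (T.clockedSet c K) v := by
    subst hv
    obtain ⟨w, hw⟩ := T.exists_vertex_eq v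
    obtain ⟨k, hk⟩ := T.exists_reached v.1 w
    rw [hw] at hk
    exact hk.mono ((clockedSet_subset k).trans_eq (hK K le_rfl).symm)
  refine ⟨fun v hv => hK K le_rfl ▸ (hall v hv).reflTransGen, fun v hv hvr => ?_,
    fun w hw => vertex_ne_root_of_mem hw⟩
  obtain ⟨a, ha, hav⟩ := (hall v hv).resolve_left hvr
  exact ⟨a, ⟨⟨K, ha⟩, hav⟩, fun a' ⟨ha', h⟩ => eq_of_vertex_eq ha' ⟨K, ha⟩ (h.trans hav.symm)⟩

end Finite

end PlanarTrinity

namespace PlanarTrinity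

variable {W B : Type*} {T : PlanarTrinity W B} {c : Color}

/-! ### States that extend an arborescence -/

variable (T) in
theorem card_nonroot_eq [Finite W] :
    Nat.card {v : T.Vertex // ∀ c, v ≠ T.root c} = Nat.card {w : W // w ≠ T.outer} := by
  have htriangle : ({T.outer}ᶜ : Set W).ncard + 1 = Nat.card W := by
    rw [← Set.ncard_add_ncard_compl {T.outer}, Set.ncard_singleton, add_comm]
  have hvertex : {v : T.Vertex | ∀ c, v ≠ T.root c}.ncard + 3 = Nat.card T.Vertex := by
    have hcompl : {v : T.Vertex | ∀ c, v ≠ T.root c} = (Set.range T.root)ᶜ := by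
      ext v
      simp [eq_comm]
    rw [hcompl, ← Set.ncard_add_ncard_compl (Set.range T.root), add_comm, ← Set.image_univ,
      Set.ncard_image_of_injective _ T.root_injective, Set.ncard_univ, Nat.card_zmod]
  have heuler := T.eulerTwo
  unfold Gluing.EulerTwo at heuler
  change {v : T.Vertex | ∀ c, v ≠ T.root c}.ncard = ({T.outer}ᶜ : Set W).ncard
  omega

theorem State.exists_of_injective [Finite W] {g : {v : T.Vertex // ∀ c, v ≠ T.root c} → W}
    (hg : ∀ v, T.vertex v.1.1 (g v) = v.1) (hinj : Function.Injective g) :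
    ∃ t : T.State, ∀ v, t.Matches (g v) v.1 := by
  have hout (v) : g v ≠ T.outer := fun h => v.2 _ ((hg v).symm.trans (congrArg _ h))
  let G : {v : T.Vertex // ∀ c, v ≠ T.root c} → {w : W // w ≠ T.outer} := fun v => ⟨g v, hout v⟩
  have hG : Function.Injective G := fun v v' h => hinj (congrArg Subtype.val h)
  let e := Equiv.ofBijective G (hG.bijective_of_nat_card_le T.card_nonroot_eq.ge)
  have he (v) : e.symm (G v) = v := e.symm_apply_apply v
  refine ⟨⟨e.symm, fun w => ?_⟩, fun v => ⟨hout v, congrArg Subtype.val (he v)⟩⟩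
  obtain ⟨v, rfl⟩ := e.surjective w
  exact ⟨v.1.1, (congrArg Subtype.val (he v)).trans (hg v).symm⟩

/-- Two vertices are joined by the edge of colour `c` of a white triangle that is not in `A`, that
is, by an edge not crossed by the arrows of colour `c` across `A`. -/
def CoEdge (T : PlanarTrinity W B) (c : Color) (A : Set W) (x y : T.Vertex) : Prop :=
  ∃ w ∉ A, ∃ d e, d ≠ c ∧ e ≠ c ∧ d ≠ e ∧ T.vertex d w = x ∧ T.vertex e w = y

variable {A : Set W}

/-- As in the matrix-tree theorem, a vertex of colour `c` is matched to the arrow that leads to it,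
and a vertex of another colour to its edge towards the root in the tree of edges that are not
crossed. -/
theorem exists_triangle_of_coEdge (hA : T.IsSpanningArborescence c A) {r : T.Vertex → ℕ}
    (hr : ∀ v : T.Vertex, v.1 ≠ c → v ≠ T.root (c + 1) → ∃ u, T.CoEdge c A u v ∧ r u < r v)
    {v : T.Vertex} (hv : ∀ d, v ≠ T.root d) :
    ∃ w, T.vertex v.1 w = v ∧ (w ∈ A ↔ v.1 = c) ∧
      (v.1 ≠ c → ∀ d, d ≠ c → d ≠ v.1 → r (T.vertex d w) < r v) := by
  by_cases hc : v.1 = c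
  · obtain ⟨w, ⟨hw, hwv⟩, -⟩ := hA.2.1 v hc (hv c)
    exact ⟨w, hc ▸ hwv, iff_of_true hw hc, fun h => absurd hc h⟩
  · obtain ⟨u, ⟨w, hw, d, e, hd, he, hde, rfl, rfl⟩, hlt⟩ := hr v hc (hv _)
    exact ⟨w, rfl, iff_of_false hw he,
      fun _ d' hd' hde' => Color.eq_of_ne he hd' hde' hd hde ▸ hlt⟩

theorem exists_state_of_coEdge [Finite W] (hA : T.IsSpanningArborescence c A)
    (hconn : ∀ v : T.Vertex, v.1 ≠ c →
      Relation.ReflTransGen (T.CoEdge c A) (T.root (c + 1)) v) :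
    ∃ t : T.State, ∀ w ∈ A, t.Matches w (T.vertex c w) := by
  obtain ⟨r, hr⟩ := exists_rank_of_reflTransGen (T.CoEdge c A) (T.root (c + 1))
  choose g hg_vertex hg_mem hg_lt using fun v : {v : T.Vertex // ∀ d, v ≠ T.root d} =>
    exists_triangle_of_coEdge hA (fun v hv => hr v (hconn v hv)) v.2
  have hg_color (v v') (h : g v = g v') : v.1.1 = v'.1.1 := by
    by_contra hne
    have hmem := (hg_mem v).symm.trans (h ▸ hg_mem v')
    have hv : v.1.1 ≠ c := fun hv => hne (hv.trans (hmem.1 hv).symm)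
    have hv' : v'.1.1 ≠ c := fun hv' => hne ((hmem.2 hv').trans hv'.symm)
    have hlt := hg_lt v hv _ hv' (Ne.symm hne)
    have hlt' := hg_lt v' hv' _ hv hne
    rw [h, hg_vertex v'] at hlt
    rw [← h, hg_vertex v] at hlt'
    exact lt_asymm hlt hlt'
  have hg_inj : Function.Injective g := fun v v' h => Subtype.ext <| by
    rw [← hg_vertex v, ← hg_vertex v', hg_color v v' h, h]
  obtain ⟨t, ht⟩ := State.exists_of_injective hg_vertex hg_inj
  refine ⟨t, fun w hw => ?_⟩
  have hw_root : T.vertex c w ≠ T.root c := hA.2.2 w hw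
  let v : {v : T.Vertex // ∀ d, v ≠ T.root d} :=
    ⟨T.vertex c w, fun d h => hw_root (T.color_eq_of_vertex_eq h ▸ h)⟩
  have hgv : g v = w := (hA.2.1 v rfl hw_root).unique ⟨(hg_mem v).2 rfl, hg_vertex v⟩ ⟨hw, rfl⟩
  have hmatches := ht v
  rwa [hgv] at hmatches

/-- The endpoint, other than the centre, of the edge across which the search of colour `c` enters
a triangle in the course of a turn. -/
def entryVertex (T : PlanarTrinity W B) (c : Color) : W ⊕ B → T.Vertex :=
  Sum.elim (T.vertex (c + 2)) (T.blackVertex (c + 1))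

variable {k : ℕ} {a w : W}

theorem entryVertex_glue (a : W) :
    T.entryVertex c (Sum.inr (T.glue c a)) = T.vertex (c + 1) a :=
  T.blackVertex_glue (by simp) a

theorem entryVertex_glue_symm (a : W) :
    T.entryVertex c (Sum.inl ((T.glue (c + 1)).symm (T.glue c a))) = T.vertex (c + 2) a := by
  have h : T.vertex (c + 2) ((T.glue (c + 1)).symm (T.glue c a)) = _ :=
    T.vertex_glue_symm (by simp) _
  exact h.trans (T.blackVertex_glue (by simp) a)

theorem entryVertex_glue_add_two (w : W) :
    T.entryVertex c (Sum.inr (T.glue (c + 2) w)) = T.vertex (c + 1) w :=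
  T.blackVertex_glue (by simp) w

variable (T c) in
theorem entryVertex_succ (k : ℕ) :
    T.entryVertex c (T.clockedPos c (k + 1)) = T.entryVertex c (T.clockedPos c k) ∨
    (∃ w, T.clockedPos c k = Sum.inl w ∧ w ∉ T.clockedSet c k ∧
      T.entryVertex c (T.clockedPos c (k + 1)) = T.vertex (c + 1) w) ∨
    ∃ a, T.clockedPos c k = Sum.inr (T.glue c a) ∧
      T.Reached c (T.clockedSet c k) (T.vertex c a) ∧
      T.entryVertex c (T.clockedPos c (k + 1)) = T.vertex (c + 2) a := by
  rcases T.clocked_cases c k with ⟨w, hp, hw⟩ | ⟨w, hp, hw⟩ | ⟨a, hp, ha⟩ | ⟨a, hp, ha⟩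
  · rw [(clocked_succ_of_mem hp hw).1, hp, entryVertex_glue_symm]
    exact .inl rfl
  · rw [(clocked_succ_of_notMem hp hw).1, entryVertex_glue_add_two]
    exact .inr (.inl ⟨w, hp, hw, rfl⟩)
  · rw [(clocked_succ_of_reached hp ha).1, entryVertex_glue_symm]
    exact .inr (.inr ⟨a, hp, ha, rfl⟩)
  · rw [(clocked_succ_of_not_reached hp ha).1, entryVertex_glue_add_two, hp, entryVertex_glue]
    exact .inl rfl

theorem coEdge_of_notMem (hw : w ∉ A) {d e : Color} (hd : d ≠ c) (he : e ≠ c) (hde : d ≠ e) :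
    T.CoEdge c A (T.vertex d w) (T.vertex e w) :=
  ⟨w, hw, d, e, hd, he, hde, rfl, rfl⟩

theorem reflTransGen_coEdge_entryVertex (k : ℕ) :
    Relation.ReflTransGen (T.CoEdge c (T.clockedArborescence c)) (T.root (c + 1))
      (T.entryVertex c (T.clockedPos c k)) := by
  induction k using Nat.strong_induction_on with
  | _ k ih =>
    cases k with
    | zero =>
      exact .single
        (coEdge_of_notMem outer_notMem_clockedArborescence (by simp) (by simp) (by simp))
    | succ k =>
      have hk := ih k k.lt_succ_self
      rcases T.entryVertex_succ c k with h | ⟨w, hp, hw, h⟩ | ⟨a, hp, ha, h⟩ <;> rw [h]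
      · exact hk
      · have hcenter := reached_center (T := T) (c := c) k
        rw [hp] at hk hcenter
        exact hk.tail (coEdge_of_notMem (fun h => hw (mem_clockedSet_of_reached hcenter h))
          (by simp) (by simp) (by simp))
      · by_cases hmem : a ∈ T.clockedSet c k
        · obtain ⟨j, hj, hpj⟩ := exists_lt_clockedPos_eq hp hmem
          have hj := ih j (hj.trans k.lt_succ_self)
          rwa [hpj] at hj
        · rw [hp, entryVertex_glue] at hk
          exact hk.tail (coEdge_of_notMem (fun h => hmem (mem_clockedSet_of_reached ha h))
            (by simp) (by simp) (by simp))

variable (T c) in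
theorem exists_state_clocked [Finite W] :
    ∃ t : T.State, ∀ w ∈ T.clockedArborescence c, t.Matches w (T.vertex c w) := by
  refine exists_state_of_coEdge (T.isSpanningArborescence_clockedArborescence c) fun v hv => ?_
  obtain ⟨p, hp⟩ : ∃ p, T.entryVertex c p = v := by
    rcases Color.eq_or_eq_add_one_or_eq_add_two c v.1 with h | h | h
    · exact absurd h hv
    · obtain ⟨b, hb⟩ := T.exists_blackVertex_eq v
      rw [h] at hb
      exact ⟨Sum.inr b, hb⟩
    · obtain ⟨w, hw⟩ := T.exists_vertex_eq v
      rw [h] at hw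
      exact ⟨Sum.inl w, hw⟩
  obtain ⟨k, rfl⟩ := T.clockedPos_surjective c p
  exact hp ▸ reflTransGen_coEdge_entryVertex k

/-! ### The sink is the clocked state -/

variable {s t : T.State} {h : B → ℚ}

theorem IsHeight.eq_zero_of_reflTransGen [Finite W] (hh : IsHeight s t h)
    (hs : ∀ a ∈ A, s.Matches a (T.vertex c a)) (ht : ∀ a ∈ A, t.Matches a (T.vertex c a)) {b : B}
    (hb : Relation.ReflTransGen (T.SelectedArrow c A) (T.root c) (T.blackVertex c b)) :
    h b = 0 := by
  generalize hv : T.blackVertex c b = v at hb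
  induction hb generalizing b with
  | refl => exact hh.eq_zero_of_blackVertex_eq_root hv
  | tail _ hxy ih =>
    obtain ⟨a, ha, rfl, rfl⟩ := hxy
    have hzero : h (T.glue (c + 2) a) = 0 := by
      have hsub := hh.apply_sub_apply a (c + 1)
      rw [State.chain_apply_color _ (hs a ha).ne_outer,
        State.chain_apply_color _ (ht a ha).ne_outer, (hs a ha).color_eq, (ht a ha).color_eq,
        sub_self, sub_eq_zero, Color.add_one_add_one, Color.add_one_add_two] at hsub
      exact hsub.trans (ih rfl)
    have hle := hh.le_glue_add_two (hs a ha) hv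
    have hle' := hh.neg.le_glue_add_two (ht a ha) hv
    simp only [Pi.neg_apply] at hle'
    linarith

/-- The white triangle `w` is met by the search of colour `c` within the first `k` steps. -/
def MetBefore (T : PlanarTrinity W B) (c : Color) (k : ℕ) (w : W) : Prop :=
  ∃ j < k, T.clockedPos c j = Sum.inl w

/-- The invariant of the comparison of a sink `s` with the search of colour `c`, for the entry
vertex `v` after `k` steps. A vertex of colour `c + 1` is matched to a triangle that has been met.
If a vertex of colour `c + 2` is matched to `u`, then the vertex of colour `c + 1` of `u` is matched
to a triangle that has been met. -/
def Settled (s : T.State) (c : Color) (k : ℕ) (v : T.Vertex) : Prop :=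
  (v.1 = c + 1 → ∀ u, s.Matches u v → T.MetBefore c k u) ∧
  (v.1 = c + 2 → ∀ u u', s.Matches u v → s.Matches u' (T.vertex (c + 1) u) → T.MetBefore c k u')

variable {l : ℕ} {v : T.Vertex}

theorem MetBefore.mono (hkl : k ≤ l) (h : T.MetBefore c k w) : T.MetBefore c l w :=
  let ⟨j, hj, h⟩ := h
  ⟨j, hj.trans_le hkl, h⟩

theorem Settled.mono (hkl : k ≤ l) (h : Settled s c k v) : Settled s c l v :=
  ⟨fun hv u hu => (h.1 hv u hu).mono hkl, fun hv u u' hu hu' => (h.2 hv u u' hu hu').mono hkl⟩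

theorem mem_clockedSet_of_matches (hs : ∀ a ∈ T.clockedSet c k, s.Matches a (T.vertex c a))
    (hr : T.Reached c (T.clockedSet c k) (T.vertex c w)) (hw : s.Matches w (T.vertex c w)) :
    w ∈ T.clockedSet c k := by
  obtain ⟨a, ha, haw⟩ := hr.resolve_left (hw.ne_root c)
  have hmatches := hs a ha
  rw [haw] at hmatches
  rwa [hw.triangle_eq hmatches]

theorem settled_entryVertex_succ
    (hs : ∀ a ∈ T.clockedSet c k, s.Matches a (T.vertex c a))
    (ih : ∀ j ≤ k, Settled s c j (T.entryVertex c (T.clockedPos c j))) :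
    Settled s c (k + 1) (T.entryVertex c (T.clockedPos c (k + 1))) := by
  have hk := ih k le_rfl
  rcases T.entryVertex_succ c k with h | ⟨w, hp, hw, h⟩ | ⟨a, hp, ha, h⟩ <;> rw [h]
  · exact hk.mono k.le_succ
  · refine ⟨fun _ u hu => ?_, fun h => absurd h (by simp)⟩
    have hmatches := s.matches_color fun h : w = T.outer => hu.ne_root (c + 1) (h ▸ rfl)
    have hcenter := reached_center (T := T) (c := c) k
    rw [hp] at hk hcenter
    rcases Color.eq_or_eq_add_one_or_eq_add_two c (s.color w) with h | h | h <;>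
      rw [h] at hmatches
    · exact absurd (mem_clockedSet_of_matches hs hcenter hmatches) hw
    · exact ⟨k, k.lt_succ_self, hmatches.triangle_eq hu ▸ hp⟩
    · exact (hk.2 rfl w u hmatches hu).mono k.le_succ
  · refine ⟨fun h => absurd h (by simp), fun _ u u' hu hu' => ?_⟩
    have hmatches := s.matches_color fun h : a = T.outer => hu.ne_root (c + 2) (h ▸ rfl)
    have hmet : T.MetBefore c k a → T.MetBefore c (k + 1) u' := by
      rintro ⟨j, hj, hpj⟩
      have hsettled := ih j hj.le
      rw [hpj] at hsettled
      exact (hsettled.2 rfl u u' hu hu').mono (by omega)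
    rw [hp, entryVertex_glue] at hk
    rcases Color.eq_or_eq_add_one_or_eq_add_two c (s.color a) with h | h | h <;>
      rw [h] at hmatches
    · exact hmet (exists_lt_clockedPos_eq hp (mem_clockedSet_of_matches hs ha hmatches))
    · exact hmet (hk.1 rfl a hmatches)
    · exact (hk.1 rfl u' (hu.triangle_eq hmatches ▸ hu')).mono k.le_succ

/-- If a selected arrow were matched to its third vertex, then the height between `s` and a state
that contains the clocked arborescence would be positive next to it. -/
theorem color_eq_of_not_reached [Finite W] (hsink : IsSink T.ClockwiseMove s)
    (hp : T.clockedPos c k = Sum.inr (T.glue c a))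
    (ha : ¬ T.Reached c (T.clockedSet c k) (T.vertex c a))
    (hs : ∀ a ∈ T.clockedSet c k, s.Matches a (T.vertex c a))
    (hk : Settled s c k (T.vertex (c + 1) a)) : s.color a = c := by
  have hout : a ≠ T.outer := fun h => ha (.inl (h ▸ rfl))
  have hmatches := s.matches_color hout
  rcases Color.eq_or_eq_add_one_or_eq_add_two c (s.color a) with h | h | h
  · exact h
  · rw [h] at hmatches
    obtain ⟨j, hj, hpj⟩ := hk.1 rfl a hmatches
    have hcenter := reached_center (T := T) (c := c) j
    rw [hpj] at hcenter
    exact absurd (hcenter.mono (clockedSet_mono hj.le)) ha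
  · exfalso
    obtain ⟨t, ht⟩ := T.exists_state_clocked c
    obtain ⟨f, hf⟩ := exists_isHeight s t
    have hta : t.color a = c := (ht a ⟨k + 1, mem_clockedSet_succ hp ha⟩).color_eq
    have hcenter := reached_center (T := T) (c := c) k
    rw [hp] at hcenter
    have hzero : f (T.glue c a) = 0 :=
      hf.eq_zero_of_reflTransGen hs (fun a ha => ht a ⟨k, ha⟩) hcenter.reflTransGen
    have hsub := hf.apply_sub_apply a (c + 2)
    rw [State.chain_apply_color _ hout, State.chain_apply_color _ hout, h, hta, if_neg (by simp),
      if_pos rfl, Color.add_two_add_one, Color.add_two_add_two, hzero] at hsub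
    obtain ⟨σ, u, hu⟩ := hf.exists_move (b := T.glue (c + 1) a) (by linarith)
    exact hsink σ u hu

theorem matches_and_settled_of_isSink [Finite W] (hsink : IsSink T.ClockwiseMove s) (k : ℕ) :
    (∀ a ∈ T.clockedSet c k, s.Matches a (T.vertex c a)) ∧
      Settled s c k (T.entryVertex c (T.clockedPos c k)) := by
  induction k using Nat.strong_induction_on with
  | _ k ih =>
    constructor
    · intro a ha
      obtain ⟨j, hj, hp, hr⟩ := exists_not_reached_of_mem ha
      obtain ⟨hs, hsettled⟩ := ih j hj
      rw [hp, entryVertex_glue] at hsettled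
      exact State.matches_vertex_iff.2
        ⟨fun h => hr (.inl (h ▸ rfl)), color_eq_of_not_reached hsink hp hr hs hsettled⟩
    · cases k with
      | zero =>
        exact ⟨fun h => absurd h (by simp [clockedPos, entryVertex]),
          fun _ u _ hu => absurd rfl (hu.ne_root (c + 2))⟩
      | succ k =>
        exact settled_entryVertex_succ (ih k k.lt_succ_self).1 fun j hj =>
          (ih j (Nat.lt_succ_of_le hj)).2

theorem isClockedState_of_isSink [Finite W] (hsink : IsSink T.ClockwiseMove s) :
    T.IsClockedState s := by
  intro c w
  have hsub (a) (ha : a ∈ T.clockedArborescence c) : s.Matches a (T.vertex c a) :=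
    let ⟨k, hk⟩ := ha
    (matches_and_settled_of_isSink hsink k).1 a hk
  refine ⟨fun hw => ?_, hsub w⟩
  obtain ⟨a, ⟨ha, haw : T.vertex c a = T.vertex c w⟩, -⟩ :=
    (T.isSpanningArborescence_clockedArborescence c).2.1 (T.vertex c w) rfl (hw.ne_root c)
  have hmatches := hsub a ha
  rw [haw] at hmatches
  rwa [hw.triangle_eq hmatches]

end PlanarTrinity

namespace Gluing

variable {W B : Type*} {T : Gluing W B}

/-! ### Cutting along a cycle of length three -/

/-- The gluing with the black and the white triangles exchanged. -/
def symm (T : Gluing W B) : Gluing B W where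
  glue c := (T.glue c).symm

theorem Connected.symm (hT : T.Connected) : T.symm.Connected := by
  have : Nonempty B := hT.1.map (T.glue 0)
  refine connected_of_induction fun p hp b b' hb => ?_
  have hp' (w : W) (c d : Color) (h : p (T.glue c w)) : p (T.glue d w) := hp w c d h
  have hall := hT.induction (p := fun w => ∀ c, p (T.glue c w)) (w := (T.glue 0).symm b)
    (fun b c d h e => hp' _ d e (by simpa using h c)) (fun c => hp' _ 0 c (by simpa using hb))
    ((T.glue 0).symm b')
  simpa using hall 0

/-- The elements of `α` as the proper elements of `Option α`. -/
def optionNeNone (α : Type*) : {x : Option α // x ≠ none} ≃ α :=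
  (Equiv.subtypeEquivRight fun _ => Option.ne_none_iff_isSome).trans (Equiv.optionIsSomeEquiv α)

theorem apply_eq_of_vertex_eq {α : Type*} {c : Color} {f : W → α}
    (hf : ∀ w, f (T.rot c w) = f w) {w w' : W} (h : T.vertex c w = T.vertex c w') : f w = f w' := by
  obtain ⟨n, rfl⟩ := T.vertex_eq_iff.1 h
  clear h
  induction n with
  | zero => rfl
  | succ n ih => rw [ih, add_comm, zpow_one_add, Equiv.Perm.mul_apply, hf]
  | pred n ih =>
    rw [ih, ← hf ((T.rot c ^ (-(n : ℤ) - 1)) w), ← Equiv.Perm.mul_apply, ← zpow_one_add,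
      add_sub_cancel]

/-- The black triangles in `D` and the white triangles in `I` are those inside a closed curve
that follows edges of all three colours, with the triangle `tri c` outside along the edge of
colour `c`. -/
structure IsInside (T : Gluing W B) (D : Set B) (I : Set W) (tri : Color → W) : Prop where
  tri_notMem : ∀ c, tri c ∉ I
  glue_mem_iff : ∀ c w, T.glue c w ∈ D ↔ w = tri c ∨ w ∈ I

namespace IsInside

variable {D : Set B} {I : Set W} {tri : Color → W} {J F : Type*}

theorem compl (h : T.IsInside D I tri) : T.symm.IsInside Iᶜ Dᶜ fun c => T.glue c (tri c) where
  tri_notMem c := not_not.2 ((h.glue_mem_iff c _).2 (Or.inl rfl))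
  glue_mem_iff c b := by
    obtain ⟨w, rfl⟩ := (T.glue c).surjective b
    have := h.tri_notMem c
    simp only [symm, Equiv.symm_apply_apply, Set.mem_compl_iff, h.glue_mem_iff, not_or,
      EmbeddingLike.apply_eq_iff_eq]
    grind

/-- The summand inside the curve, completed by a white triangle `none`. Its triangles are
relabelled along `i` and `j`, because `Irreducible` only speaks about summands in `Type`. -/
noncomputable def inner (h : T.IsInside D I tri) (i : J ≃ I) (j : F ≃ D) : Gluing (Option J) F where
  glue c := Equiv.ofBijective
    (fun x => j.symm ⟨T.glue c (x.elim (tri c) fun y => (i y : W)),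
      (h.glue_mem_iff c _).2 (x.casesOn (Or.inl rfl) fun y => Or.inr (i y).2)⟩) <| by
    constructor
    · intro x y hxy
      have hxy := (T.glue c).injective (congrArg Subtype.val (j.symm.injective hxy))
      rcases x with _ | x <;> rcases y with _ | y
      · rfl
      · exact absurd ((show tri c = i y from hxy) ▸ (i y).2) (h.tri_notMem c)
      · exact absurd ((show i x = tri c from hxy) ▸ (i x).2) (h.tri_notMem c)
      · exact congrArg some (i.injective (Subtype.ext hxy))
    · intro b
      rcases (h.glue_mem_iff c ((T.glue c).symm (j b))).1 (by simp) with hw | hw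
      · exact ⟨none, by simp [← hw]⟩
      · exact ⟨some (i.symm ⟨_, hw⟩), by simp⟩

section inner

variable (h : T.IsInside D I tri) (i : J ≃ I) (j : F ≃ D)

@[simp] theorem coe_inner_glue_none (c : Color) :
    (j ((h.inner i j).glue c none) : B) = T.glue c (tri c) :=
  congrArg Subtype.val (j.apply_symm_apply _)

@[simp] theorem coe_inner_glue_some (c : Color) (x : J) :
    (j ((h.inner i j).glue c (some x)) : B) = T.glue c (i x) :=
  congrArg Subtype.val (j.apply_symm_apply _)

theorem inner_connected (hT : T.Connected) : (h.inner i j).Connected := by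
  refine connected_of_induction fun p hp x x' hx => ?_
  let i' : J → W := fun x => i x
  have hi' : Function.Injective i' := Subtype.val_injective.comp i.injective
  let collapse : W → Option J := Function.extend i' some fun _ => none
  have hsome (x : J) : collapse (i' x) = some x := hi'.extend_apply _ _ x
  have hnone {w : W} (hw : w ∉ I) : collapse w = none :=
    Function.extend_apply' _ _ _ fun ⟨x, hx⟩ => hw (hx ▸ (i x).2)
  have hin (b : F) (c : Color) :
      collapse ((T.glue c).symm (j b)) = ((h.inner i j).glue c).symm b := by
    obtain ⟨_ | y, rfl⟩ := ((h.inner i j).glue c).surjective b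
    · simp [hnone (h.tri_notMem c)]
    · simpa using hsome y
  have hstep (b : B) (c d : Color) (hb : p (collapse ((T.glue c).symm b))) :
      p (collapse ((T.glue d).symm b)) := by
    by_cases hbD : b ∈ D
    · obtain ⟨b, rfl⟩ : ∃ b', (j b' : B) = b := ⟨j.symm ⟨b, hbD⟩, by simp⟩
      rw [hin] at hb ⊢
      exact hp b c d hb
    · have hout (c : Color) : collapse ((T.glue c).symm b) = none :=
        hnone fun hw => hbD (by simpa using (h.glue_mem_iff c _).2 (Or.inr hw))
      rw [hout] at hb ⊢
      exact hb
  have hsurj (x : Option J) : ∃ w, collapse w = x :=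
    x.casesOn ⟨tri 0, hnone (h.tri_notMem 0)⟩ fun x => ⟨i' x, hsome x⟩
  obtain ⟨w, rfl⟩ := hsurj x
  obtain ⟨w', rfl⟩ := hsurj x'
  exact hT.induction (p := p ∘ collapse) hstep hx w'

theorem blackVertex_eq_of_inner (hcyc : ∀ c, T.vertex c (tri (c + 1)) = T.vertex c (tri (c + 2)))
    {c : Color} {b b' : F} (hb : (h.inner i j).blackVertex c b = (h.inner i j).blackVertex c b') :
    T.blackVertex c (j b) = T.blackVertex c (j b') := by
  have hrot (x : Option J) : T.blackVertex c (j ((h.inner i j).glue (c + 2) x)) =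
      T.blackVertex c (j ((h.inner i j).glue (c + 1) x)) := by
    cases x <;> simp [T.blackVertex_glue, hcyc]
  simpa using apply_eq_of_vertex_eq
    (f := fun x => T.blackVertex c (j ((h.inner i j).glue (c + 1) x))) (by simpa using hrot) hb

theorem ncard_regionVertices_le [Finite J]
    (hcyc : ∀ c, T.vertex c (tri (c + 1)) = T.vertex c (tri (c + 2))) :
    (T.regionVertices D).ncard ≤ Nat.card (h.inner i j).Vertex := by
  choose b hbD hb using fun v : T.regionVertices D => v.2
  rw [← Nat.card_coe_set_eq]
  refine Nat.card_le_card_of_injective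
    (fun v => (h.inner i j).blackVertex v.1.1 (j.symm ⟨b v, hbD v⟩)) fun v v' hv => ?_
  have hcol : v.1.1 = v'.1.1 := congrArg (fun u : (h.inner i j).Vertex => u.1) hv
  simp only [hcol] at hv
  have := h.blackVertex_eq_of_inner i j hcyc hv
  rw [← hcol, Equiv.apply_symm_apply, Equiv.apply_symm_apply, hb, hcol, hb] at this
  exact Subtype.ext this

end inner

section outer

variable {J' F' : Type*} (h : T.IsInside D I tri) (i : J ≃ I) (j : F ≃ D) (i' : J' ≃ (Iᶜ : Set W))
  (j' : F' ≃ (Dᶜ : Set B))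

/-- The summand outside the curve, completed by a black triangle `none`. -/
noncomputable def outer : Gluing J' (Option F') := (h.compl.inner j' i').symm

theorem coe_outer_glue_symm_none (c : Color) :
    (i' (((h.outer i' j').glue c).symm none) : W) = tri c :=
  (h.compl.coe_inner_glue_none j' i' c).trans ((T.glue c).symm_apply_apply _)

theorem coe_outer_glue_symm_some (c : Color) (y : F') :
    (i' (((h.outer i' j').glue c).symm (some y)) : W) = (T.glue c).symm (j' y) :=
  h.compl.coe_inner_glue_some j' i' c y

theorem iso_connectedSum : Iso T (connectedSum (h.outer i' j') none (h.inner i j) none) := by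
  classical
  let f := (((Equiv.refl J').sumCongr (optionNeNone J)).trans (Equiv.sumComm J' J)).trans
    ((i.sumCongr i').trans (Equiv.Set.sumCompl I))
  let g := (((optionNeNone F').sumCongr (Equiv.refl F)).trans (Equiv.sumComm F' F)).trans
    ((j.sumCongr j').trans (Equiv.Set.sumCompl D))
  refine ⟨f.symm, g.symm, fun c w => ?_⟩
  obtain ⟨x, rfl⟩ := f.surjective w
  rw [f.symm_apply_apply, Equiv.symm_apply_eq]
  rcases x with x | ⟨_ | x, hx⟩
  · obtain ⟨_ | y, rfl⟩ := ((h.outer i' j').glue c).symm.surjective x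
    · simp [f, g, connectedSum, h.coe_outer_glue_symm_none]
    · simp [f, g, connectedSum, h.coe_outer_glue_symm_some, optionNeNone]
  · exact absurd rfl hx
  · simp [f, g, connectedSum, optionNeNone]

end outer

end IsInside

theorem Irreducible.eq_empty_of_isInside [Finite W] (hirr : T.Irreducible) (hT : T.Connected)
    {D : Set B} {I : Set W} {tri : Color → W} (h : T.IsInside D I tri)
    (htri : Function.Injective tri)
    (hcyc : ∀ c, T.vertex c (tri (c + 1)) = T.vertex c (tri (c + 2)))
    (hcard : I.ncard + 3 ≤ (T.regionVertices D).ncard) : I = ∅ := by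
  have : Finite B := .of_equiv W (T.glue 0)
  have i := (Finite.equivFin I).symm
  have j := (Finite.equivFin D).symm
  have i' := (Finite.equivFin (Iᶜ : Set W)).symm
  have j' := (Finite.equivFin (Dᶜ : Set B)).symm
  have hinner := h.inner_connected i j hT
  have houter : (h.outer i' j').Connected := (h.compl.inner_connected j' i' hT.symm).symm
  have hI : Nat.card (Option (Fin (Nat.card I))) = I.ncard + 1 := by
    simp [Nat.card_coe_set_eq]
  have heuler : (h.inner i j).EulerTwo := by
    have := hinner.card_vertex_le
    have := h.ncard_regionVertices_le i j hcyc
    unfold EulerTwo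
    omega
  rcases hirr.2 _ _ _ _ _ none _ none inferInstance inferInstance houter hinner heuler
    (h.iso_connectedSum i j i' j') with hcard | hcard
  · have := (Nat.card_eq_one_iff_unique.1 hcard).1
    have htri' : (⟨tri 0, h.tri_notMem 0⟩ : (Iᶜ : Set W)) = ⟨tri 1, h.tri_notMem 1⟩ :=
      i'.symm.injective (Subsingleton.elim _ _)
    exact absurd (htri (congrArg Subtype.val htri')) (by decide)
  · rw [← Set.ncard_eq_zero]
    omega

end Gluing

namespace PlanarTrinity

variable {W B : Type*} {T : PlanarTrinity W B} {s t : T.State} {σ : T.Site}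

theorem IsPosition.isInside (h : IsPosition 1 s σ) {D : Set B} {f : W → W}
    (hD : T.IsRegion D σ.triangles s.color f) :
    T.IsInside D (T.regionTriangles D \ σ.triangles) σ.tri where
  tri_notMem c hc := hc.2 (Site.mem_triangles.2 ⟨c, rfl⟩)
  glue_mem_iff c w := by
    by_cases hw : w ∈ σ.triangles
    · obtain ⟨d, rfl⟩ := Site.mem_triangles.1 hw
      simp [hD.glue_mem_iff _ hw, h.color_tri, hw, h.tri_injective.eq_iff, eq_comm]
    · have hne : w ≠ σ.tri c := fun hwc => hw (Site.mem_triangles.2 ⟨c, hwc.symm⟩)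
      simpa [hw, hne] using ⟨fun hc => ⟨c, hc⟩, fun ⟨d, hd⟩ => hD.glue_mem w hw d c hd⟩

theorem exists_eq_blackSite [Finite W] (hirr : T.Irreducible) (hm : T.ClockwiseMove σ s t) :
    ∃ b, σ = T.blackSite b := by
  classical
  have hmove := clockwiseMove_iff.1 hm
  have hpos := hmove.source
  obtain ⟨h, -, -, hD⟩ := hmove.exists_isHeight
  set D : Set B := {b | h b = 1}
  have hin := hpos.isInside hD
  have htriangles : σ.triangles.card = 3 :=
    Finset.card_image_of_injective _ hpos.tri_injective
  have hcard := Set.ncard_sdiff_add_ncard_of_subset (s := (σ.triangles : Set W))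
    (t := T.regionTriangles D) fun w hw => hD.mem_regionTriangles hw
  rw [Set.ncard_coe_finset, htriangles] at hcard
  have hempty := hirr.eq_empty_of_isInside T.connected hin hpos.tri_injective σ.cycle
    (hcard.trans_le (hpos.isTurn.ncard_regionTriangles_le hD))
  have hD1 : D.ncard = 1 := by
    have := hD.ncard_faces
    rw [hempty, Set.ncard_empty] at hcard
    omega
  obtain ⟨b, hb⟩ := Set.ncard_eq_one.1 hD1
  refine ⟨b, Site.ext (funext fun c => (T.glue c).eq_symm_apply.2 ?_)⟩
  rw [← Set.mem_singleton_iff, ← hb]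
  exact (hin.glue_mem_iff c _).2 (Or.inl rfl)

/-! ### The clock theorem -/

theorem labeledPath_iff {l : List T.Site} :
    LabeledPath T.ClockwiseMove s l t ↔ T.ClockwisePath s l t := by
  constructor <;> intro h
  · induction h with
    | nil s => exact .nil s
    | cons h _ ih => exact .cons h ih
  · induction h with
    | nil s => exact .nil s
    | cons h _ ih => exact .cons h ih

theorem ClockwisePath.reachable [Finite W] {l : List T.Site} (h : T.ClockwisePath s l t) :
    T.transitionGraph.Reachable s t := by
  obtain ⟨r, hr⟩ := T.exists_lt_of_clockwiseMove
  induction h with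
  | nil => exact .refl _
  | @cons σ _ s t _ h _ ih =>
    refine .trans (SimpleGraph.Adj.reachable ?_) ih
    exact (SimpleGraph.fromRel_adj _ _ _).2
      ⟨fun hst => (hr σ s t h).ne (congrArg r hst), .inl ⟨σ, h⟩⟩

instance [Finite W] : Nonempty T.State := (T.exists_state_clocked 0).nonempty

theorem exists_isSink [Finite W] (T : PlanarTrinity W B) :
    ∃ m : T.State, IsSink T.ClockwiseMove m ∧ ∀ s, ∃ l, LabeledPath T.ClockwiseMove s l m :=
  T.exists_lt_of_clockwiseMove.elim fun _ hr =>
    exists_isSink_of_unique hr fun _ _ => eq_of_isSink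

theorem exists_isSource [Finite W] (T : PlanarTrinity W B) :
    ∃ a : T.State, IsSink (fun σ => flip (T.ClockwiseMove σ)) a ∧
      ∀ s, ∃ l, LabeledPath (fun σ => flip (T.ClockwiseMove σ)) s l a := by
  obtain ⟨r, hr⟩ := T.exists_lt_of_clockwiseMove
  obtain ⟨m, -, hup⟩ := T.exists_isSink
  refine exists_isSink_of_unique (r := OrderDual.toDual ∘ r) (fun σ s t h => hr σ t s h)
    fun s t hs ht => ?_
  obtain ⟨l, hl⟩ := hup s
  obtain ⟨l', hl'⟩ := hup t
  exact T.isCommuting_flip_clockwiseMove.sink_eq hl.reverse hl'.reverse hs ht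

theorem transitionGraph_connected [Finite W] (T : PlanarTrinity W B) :
    T.transitionGraph.Connected := by
  obtain ⟨m, -, hup⟩ := T.exists_isSink
  have hm (s) : T.transitionGraph.Reachable s m :=
    (hup s).elim fun _ hl => (labeledPath_iff.1 hl).reachable
  exact .mk fun s t => (hm s).trans (hm t).symm

end PlanarTrinity

theorem theorem4p2 {W B : Type*} [Finite W] (T : PlanarTrinity W B) :
    T.transitionGraph.Connected ∧
    (∃ (L : DistribLattice T.State) (a m : T.State) (φ : T.State → T.Site → ℕ),
      -- the order: going up is performing clockwise moves
      (∀ s t, L.le s t ↔ ∃ l, T.ClockwisePath s l t) ∧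
      -- `a` is the unique minimum, and the lattice operations are those of the multiplicities
      (∀ s, L.le a s) ∧
      (∀ s, (∀ σ t, ¬ T.ClockwiseMove σ t s) ↔ s = a) ∧
      T.IsMultiplicity a φ ∧
      Function.Injective φ ∧
      (∀ s t, L.le s t ↔ φ s ≤ φ t) ∧
      (∀ s t, φ (L.inf s t) = φ s ⊓ φ t) ∧
      (∀ s t, φ (L.sup s t) = φ s ⊔ φ t) ∧
      -- `m` is the unique maximum, and it is the clocked state
      (∀ s, L.le s m) ∧
      (∀ s, (∀ σ t, ¬ T.ClockwiseMove σ s t) ↔ s = m) ∧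
      (∀ c, T.IsSpanningArborescence c (T.clockedArborescence c)) ∧
      T.IsClockedState m) ∧
    -- in the irreducible case all clock moves are about black triangles
    (T.Irreducible → ∀ σ s t, T.ClockwiseMove σ s t → ∃ b, σ = T.blackSite b) := by
  classical
  obtain ⟨m, hm, hup⟩ := T.exists_isSink
  obtain ⟨a, ha, hdown⟩ := T.exists_isSource
  have hM := T.isCommuting_clockwiseMove
  have hM' := T.isCommuting_flip_clockwiseMove
  obtain ⟨φ, hφ⟩ := hM.exists_isLabelCount hm hup fun s => (hdown s).imp' _ fun _ h => h.reverse
  obtain ⟨L, hle, hinf, hsup⟩ := exists_distribLattice_of_injective (hφ.injective hM)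
    (hφ.exists_sup hM) (hφ.exists_inf hM' hup)
  have hpath (s t) : L.le s t ↔ ∃ l, LabeledPath T.ClockwiseMove s l t :=
    (hle s t).trans (hφ.le_iff hM)
  have hmult : T.IsMultiplicity a φ := fun s =>
    ⟨(hφ.exists_path s).imp fun _ => PlanarTrinity.labeledPath_iff.1,
      fun _ hl => hφ.count_eq (PlanarTrinity.labeledPath_iff.2 hl)⟩
  exact ⟨T.transitionGraph_connected,
    ⟨L, a, m, φ, by simpa only [PlanarTrinity.labeledPath_iff] using hpath,
      fun s => (hpath a s).2 (hφ.exists_path s), fun _ => ha.iff_eq hdown, hmult, hφ.injective hM,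
      hle, hinf, hsup, fun s => (hpath s m).2 (hup s), fun _ => hm.iff_eq hup,
      fun c => T.isSpanningArborescence_clockedArborescence c,
      PlanarTrinity.isClockedState_of_isSink hm⟩,
    fun hirr _ _ _ => PlanarTrinity.exists_eq_blackSite hirr⟩
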